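/- Let $m\ge 4$ and let $e_1,\dots,e_{2m}$ be the standard basis of $\mathbb{C}^{2m}$, equipped with the symmetric bilinear form $(e_i,e_j)=\delta_{i,2m+1-j}$. Let $\mathfrak{so}_{2m}$ be the Lie algebra of endomorphisms of $\mathbb{C}^{2m}$ that are skew for this form, with the Cartan subalgebra $\mathfrak h$ of diagonal matrices and $\mathfrak n$ the strictly upper triangular matrices in $\mathfrak{so}_{2m}$; let $\psi=\varepsilon_1+\varepsilon_2$ be its highest root, where $\varepsilon_i\in\mathfrak h^*$ takes the $i$-th diagonal entry. Let $V_{2\psi}$ denote the finite-dimensional irreducible representation of $\mathfrak{so}_{2m}$ of highest weight $2\psi$. For $f\in(\mathbb{C}^{2m})^*$ let $\iota_f:\bigwedge^2\mathbb{C}^{2m}\to\mathbb{C}^{2m}$ be the contraction $\iota_f(v\wedge w)=f(v)w-f(w)v$. Identify $\bigwedge^2\mathbb{C}^{2m}$ with $\mathfrak{so}_{2m}$ by sending $v\wedge w$ to the endomorphism $u\mapsto (v,u)w-(w,u)v$, and let $\mathrm{Sym}^2(\mathfrak{so}_{2m})^*$ be the space of homogeneous quadratic polynomial functions on $\mathfrak{so}_{2m}=\bigwedge^2\mathbb{C}^{2m}$,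 with the $\mathfrak{so}_{2m}$-action induced by the adjoint action. Define linear maps $$\Phi:\Big(\bigwedge\nolimits^4\mathbb{C}^{2m}\Big)^*\to \mathbb{C}\Big[\bigwedge\nolimits^2\mathbb{C}^{2m}\Big],\quad \Phi(\varphi)(\alpha)=\varphi(\alpha\wedge\alpha),$$ $$\Psi:\mathrm{Sym}^2(\mathbb{C}^{2m})^*\to \mathbb{C}\Big[\bigwedge\nolimits^2\mathbb{C}^{2m}\Big],\quad \Psi(f\cdot g)(\alpha)=(\iota_f\alpha,\iota_g\alpha),$$ which take values in quadratic functions, and let $V_{\mathrm{dec}}$ and $V_{\mathrm{iso}}$ be the images of $\Phi$ and $\Psi$. Then $\Phi$ and $\Psi$ are injective, $V_{\mathrm{dec}}$ and $V_{\mathrm{iso}}$ are subrepresentations of $\mathrm{Sym}^2(\mathfrak{so}_{2m})^*$, and $$\mathrm{Sym}^2(\mathfrak{so}_{2m})^*=V_{2\psi}^*\oplus V_{\mathrm{dec}}\oplus V_{\mathrm{iso}}$$ as $\mathfrak{so}_{2m}$-representations; that is, $\mathrm{Sym}^2(\mathfrak{so}_{2m})^*$ is the internal direct sum of $V_{\mathrm{dec}}$,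 $V_{\mathrm{iso}}$ and a subrepresentation isomorphic to the dual of $V_{2\psi}$. -/

import Mathlib

open scoped TensorProduct
open Module

attribute [local instance] LieRing.ofAssociativeRing

noncomputable section

namespace SOQuad

/-! ### The orthogonal Lie algebra -/

/-- The space `ℂ^{2m}`. -/
abbrev V (m : ℕ) : Type := Fin (2 * m) → ℂ

/-- The standard basis vectors `e_i`. -/
abbrev e {m : ℕ} (i : Fin (2 * m)) : V m := Pi.single i 1

/-- The symmetric bilinear form with `(e_i, e_j) = δ_{i, 2m+1-j}` (indices starting at `1`). -/
def form (m : ℕ) : LinearMap.BilinForm ℂ (V m) :=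
  LinearMap.mk₂ ℂ (fun v w => ∑ i, v i * w i.rev)
    (by intros; simp [add_mul, Finset.sum_add_distrib])
    (by intros; simp [mul_assoc, Finset.mul_sum])
    (by intros; simp [mul_add, Finset.sum_add_distrib])
    (by intros; simp [mul_left_comm, Finset.mul_sum])

theorem form_apply {m : ℕ} (v w : V m) : form m v w = ∑ i, v i * w i.rev := rfl

theorem form_e_left {m : ℕ} (i : Fin (2 * m)) (w : V m) : form m (e i) w = w i.rev := by
  simp [form_apply, Pi.single_apply]

theorem form_e_e {m : ℕ} (i j : Fin (2 * m)) :
    form m (e i) (e j) = if i = j.rev then 1 else 0 := by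
  simp [form_e_left, Pi.single_apply, Fin.rev_eq_iff]

theorem form_comm {m : ℕ} (v w : V m) : form m v w = form m w v := by
  rw [form_apply, form_apply, ← Equiv.sum_comp Fin.revPerm]
  simp [mul_comm]

theorem form_e_right {m : ℕ} (i : Fin (2 * m)) (w : V m) : form m w (e i) = w i.rev := by
  rw [form_comm, form_e_left]

theorem sum_form_smul {m : ℕ} (w : V m) : ∑ i : Fin (2 * m), form m w (e i) • e i.rev = w := by
  simp only [form_e_right]
  rw [← Equiv.sum_comp Fin.revPerm]
  ext j
  simp [Finset.sum_apply, Pi.single_apply]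

theorem sum_smul_e {m : ℕ} (w : V m) : ∑ i : Fin (2 * m), w i • e i = w := by
  ext j
  simp [Finset.sum_apply, Pi.single_apply]

theorem form_nondeg {m : ℕ} {v w : V m} (h : ∀ u, form m u v = form m u w) : v = w := by
  ext i
  have := h (e i.rev)
  simpa [form_e_left] using this

/-- `so_{2m}`: the endomorphisms of `ℂ^{2m}` that are skew with respect to the form. -/
abbrev so (m : ℕ) : LieSubalgebra ℂ (Module.End ℂ (V m)) :=
  skewAdjointLieSubalgebra (form m)

theorem mem_so_iff {m : ℕ} (X : Module.End ℂ (V m)) :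
    X ∈ so m ↔ ∀ v w, form m (X v) w = - form m v (X w) := by
  change X ∈ (form m).skewAdjointSubmodule ↔ _
  simp [LinearMap.mem_skewAdjointSubmodule, LinearMap.IsSkewAdjoint, LinearMap.IsAdjointPair]

/-- The `(i, j)` matrix entry of an element of `so_{2m}`. -/
def entry {m : ℕ} (X : so m) (i j : Fin (2 * m)) : ℂ := LinearMap.toMatrix' X.1 i j

theorem entry_eq {m : ℕ} (X : so m) (i j : Fin (2 * m)) : entry X i j = X.1 (e j) i := by
  simp [entry, LinearMap.toMatrix'_apply]

theorem entry_zero {m : ℕ} (i j : Fin (2 * m)) : entry (0 : so m) i j = 0 := by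
  simp [entry]

theorem entry_add {m : ℕ} (X Y : so m) (i j : Fin (2 * m)) :
    entry (X + Y) i j = entry X i j + entry Y i j := by
  simp [entry]

theorem entry_smul {m : ℕ} (c : ℂ) (X : so m) (i j : Fin (2 * m)) :
    entry (c • X) i j = c * entry X i j := by
  simp [entry]

theorem entry_lie {m : ℕ} (X Y : so m) (i j : Fin (2 * m)) :
    entry ⁅X, Y⁆ i j = ∑ k, entry X i k * entry Y k j - ∑ k, entry Y i k * entry X k j := by
  simp only [entry, LieSubalgebra.coe_bracket, Ring.lie_def, map_sub, Matrix.sub_apply,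
    LinearMap.toMatrix'_mul, Matrix.mul_apply]

/-- The Cartan subalgebra of diagonal matrices. -/
def cartan (m : ℕ) : LieSubalgebra ℂ (so m) where
  carrier := {X | ∀ i j : Fin (2 * m), i ≠ j → entry X i j = 0}
  add_mem' hX hY i j hij := by rw [entry_add, hX i j hij, hY i j hij, add_zero]
  zero_mem' i j _ := entry_zero i j
  smul_mem' c X hX i j hij := by rw [entry_smul, hX i j hij, mul_zero]
  lie_mem' := by
    have key : ∀ A B : so m, (∀ i j : Fin (2 * m), i ≠ j → entry A i j = 0) →
        (∀ i j : Fin (2 * m), i ≠ j → entry B i j = 0) → ∀ i j : Fin (2 * m), i ≠ j →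
        ∑ k, entry A i k * entry B k j = 0 := by
      intro A B hA hB i j hij
      refine Finset.sum_eq_zero fun k _ => ?_
      by_cases hk : i = k
      · subst hk; rw [hB i j hij, mul_zero]
      · rw [hA i k hk, zero_mul]
    intro X Y hX hY i j hij
    rw [entry_lie, key X Y hX hY i j hij, key Y X hY hX i j hij, sub_zero]

/-- The nilpotent subalgebra `𝔫` (the sum of the positive root spaces) of strictly upper
triangular matrices. -/
def nilp (m : ℕ) : LieSubalgebra ℂ (so m) where
  carrier := {X | ∀ i j : Fin (2 * m), j ≤ i → entry X i j = 0}
  add_mem' hX hY i j hij := by rw [entry_add, hX i j hij, hY i j hij, add_zero]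
  zero_mem' i j _ := entry_zero i j
  smul_mem' c X hX i j hij := by rw [entry_smul, hX i j hij, mul_zero]
  lie_mem' := by
    have key : ∀ A B : so m, (∀ i j : Fin (2 * m), j ≤ i → entry A i j = 0) →
        (∀ i j : Fin (2 * m), j ≤ i → entry B i j = 0) → ∀ i j : Fin (2 * m), j ≤ i →
        ∑ k, entry A i k * entry B k j = 0 := by
      intro A B hA hB i j hij
      refine Finset.sum_eq_zero fun k _ => ?_
      by_cases hk : k ≤ i
      · rw [hA i k hk, zero_mul]
      · rw [hB k j (hij.trans (le_of_not_ge hk)), mul_zero]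
    intro X Y hX hY i j hij
    rw [entry_lie, key X Y hX hY i j hij, key Y X hY hX i j hij, sub_zero]

/-! ### Highest weights -/

/-- `W` has a nonzero vector of weight `μ` annihilated by `𝔫`. -/
def HasHighestWeightVector (m : ℕ) (W : Type*) [AddCommGroup W] [Module ℂ W]
    [LieRingModule (so m) W] (μ : Dual ℂ (cartan m)) : Prop :=
  ∃ w : W, w ≠ 0 ∧ (∀ H : cartan m, ⁅(H : so m), w⁆ = μ H • w) ∧
    ∀ X ∈ nilp m, ⁅X, w⁆ = 0

/-- `W` is a (finite-dimensional) irreducible representation of `so_{2m}` of highest weight `μ`,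
i.e. `W` is a model of `V_μ`. -/
structure IsIrrepOfHighestWeight (m : ℕ) (W : Type*) [AddCommGroup W] [Module ℂ W]
    [LieRingModule (so m) W] [LieModule ℂ (so m) W] (μ : Dual ℂ (cartan m)) : Prop where
  finiteDimensional : FiniteDimensional ℂ W
  irreducible : LieModule.IsIrreducible ℂ (so m) W
  highestWeight : HasHighestWeightVector m W μ

/-- The weight `ε_i` of the Cartan subalgebra, taking a diagonal matrix to its `i`-th entry. -/
def eps {m : ℕ} (i : Fin (2 * m)) : Dual ℂ (cartan m) where
  toFun H := entry (H : so m) i i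
  map_add' _ _ := entry_add _ _ i i
  map_smul' c _ := entry_smul c _ i i

/-- The highest root `ψ = ε₁ + ε₂` of `so_{2m}` (see `highestRoot_spec`). -/
def highestRoot (m : ℕ) (hm : 4 ≤ m) : Dual ℂ (cartan m) :=
  eps ⟨0, by omega⟩ + eps ⟨1, by omega⟩

/-! ### Bivectors and `so_{2m}` -/

/-- The bivector `v ∧ w`. -/
def wedge {m : ℕ} (v w : V m) : ⋀[ℂ]^2 (V m) := exteriorPower.ιMulti ℂ 2 ![v, w]

theorem coe_wedge {m : ℕ} (v w : V m) :
    (wedge v w : ExteriorAlgebra ℂ (V m)) = ExteriorAlgebra.ι ℂ v * ExteriorAlgebra.ι ℂ w := by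
  simp [wedge, ExteriorAlgebra.ιMulti_apply]

theorem wedge_ext {m : ℕ} {N : Type*} [AddCommGroup N] [Module ℂ N]
    {f g : ⋀[ℂ]^2 (V m) →ₗ[ℂ] N} (h : ∀ v w, f (wedge v w) = g (wedge v w)) : f = g := by
  apply exteriorPower.linearMap_ext
  ext a
  have : a = ![a 0, a 1] := by ext i : 1; fin_cases i <;> rfl
  rw [this]
  exact h _ _

/-- The bilinear map `(v, w) ↦ v ∧ w`. -/
def wedgeₗ (m : ℕ) : V m →ₗ[ℂ] V m →ₗ[ℂ] ⋀[ℂ]^2 (V m) :=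
  LinearMap.mk₂ ℂ wedge
    (by intros; apply Subtype.ext; simp [coe_wedge, add_mul])
    (by intros; apply Subtype.ext; simp [coe_wedge])
    (by intros; apply Subtype.ext; simp [coe_wedge, mul_add])
    (by intros; apply Subtype.ext; simp [coe_wedge])

theorem wedgeₗ_apply {m : ℕ} (v w : V m) : wedgeₗ m v w = wedge v w := rfl

theorem wedge_swap {m : ℕ} (v w : V m) : wedge v w = - wedge w v := by
  apply Subtype.ext
  simp only [coe_wedge, NegMemClass.coe_neg]
  exact eq_neg_of_add_eq_zero_left (ExteriorAlgebra.ι_add_mul_swap v w)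

/-- The contraction `ι_f α ∈ ℂ^{2m}` of a bivector `α` by a covector `f`; on `v ∧ w` it is
`f(v) w - f(w) v`. -/
def contract (m : ℕ) : Dual ℂ (V m) →ₗ[ℂ] ⋀[ℂ]^2 (V m) →ₗ[ℂ] V m :=
  LinearMap.mk₂ ℂ
    (fun f α => ExteriorAlgebra.ιInv (CliffordAlgebra.contractLeft f (α : ExteriorAlgebra ℂ (V m))))
    (by intros; simp) (by intros; simp) (by intros; simp) (by intros; simp)

theorem contract_wedge {m : ℕ} (f : Dual ℂ (V m)) (v w : V m) :
    contract m f (wedge v w) = f v • w - f w • v := by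
  simp only [contract, LinearMap.mk₂_apply, coe_wedge]
  unfold ExteriorAlgebra.ι
  rw [CliffordAlgebra.contractLeft_ι_mul, CliffordAlgebra.contractLeft_ι, ← Algebra.commutes,
    ← Algebra.smul_def, map_sub, map_smul, map_smul]
  have := ExteriorAlgebra.ι_leftInverse (R := ℂ) (M := V m)
  erw [this v, this w]

/-- The endomorphism `φ_α : u ↦ ι_{(·, u)} α`; for `α = v ∧ w` it is `u ↦ (v, u) w - (w, u) v`. -/
def bivectorEnd (m : ℕ) : ⋀[ℂ]^2 (V m) →ₗ[ℂ] Module.End ℂ (V m) :=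
  LinearMap.flip ((contract m).comp (form m).flip)

theorem bivectorEnd_wedge {m : ℕ} (v w u : V m) :
    bivectorEnd m (wedge v w) u = form m v u • w - form m w u • v := by
  simp [bivectorEnd, contract_wedge]

theorem bivectorEnd_mem {m : ℕ} (α : ⋀[ℂ]^2 (V m)) : bivectorEnd m α ∈ so m := by
  rw [mem_so_iff]
  intro v w
  have : (((form m).flip w) ∘ₗ (LinearMap.applyₗ v) ∘ₗ bivectorEnd m) =
      - ((form m v) ∘ₗ (LinearMap.applyₗ w) ∘ₗ bivectorEnd m) := by
    apply wedge_ext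
    intro a b
    simp [bivectorEnd_wedge, form_comm v]
    ring
  exact LinearMap.congr_fun this α

/-- The bivector `½ ∑ e_{i'} ∧ X e_i` attached to `X ∈ so_{2m}`, where `i' = 2m + 1 - i`. -/
def toBivector (m : ℕ) : so m →ₗ[ℂ] ⋀[ℂ]^2 (V m) where
  toFun X := (2⁻¹ : ℂ) • ∑ i : Fin (2 * m), wedge (e i.rev) (X.1 (e i))
  map_add' X Y := by
    simp [← wedgeₗ_apply, Finset.sum_add_distrib]
  map_smul' c X := by
    simp only [← wedgeₗ_apply, SetLike.val_smul, LinearMap.smul_apply, map_smul, RingHom.id_apply,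
      ← Finset.smul_sum]
    rw [smul_comm]

/-- The identification `⋀² ℂ^{2m} = so_{2m}`,
`v ∧ w ↦ (u ↦ (v, u) w - (w, u) v)`. -/
def bivectorEquiv (m : ℕ) : ⋀[ℂ]^2 (V m) ≃ₗ[ℂ] so m :=
  LinearEquiv.ofLinearMap ((bivectorEnd m).codRestrict (so m).toSubmodule bivectorEnd_mem)
    (toBivector m)
    (by
      ext X : 1
      apply Subtype.ext
      have hX := (mem_so_iff X.1).1 X.2
      refine LinearMap.ext fun u => ?_
      change bivectorEnd m ((2⁻¹ : ℂ) • ∑ i : Fin (2 * m), wedge (e i.rev) (X.1 (e i))) u = X.1 u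
      have h1 : ∑ i : Fin (2 * m), form m (e i.rev) u • X.1 (e i) = X.1 u := by
        conv_rhs => rw [← sum_smul_e u, map_sum]
        simp [form_e_left]
      have h2 : ∑ i : Fin (2 * m), form m (X.1 (e i)) u • e i.rev = - X.1 u := by
        conv_rhs => rw [← sum_form_smul (X.1 u), ← Finset.sum_neg_distrib]
        refine Finset.sum_congr rfl fun i _ => ?_
        rw [hX, form_comm (e i), neg_smul]
      simp only [map_smul, map_sum, LinearMap.smul_apply, LinearMap.sum_apply, bivectorEnd_wedge,
        Finset.sum_sub_distrib, h1, h2, sub_neg_eq_add, ← two_smul ℂ (X.1 u), smul_smul]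
      norm_num)
    (by
      apply wedge_ext
      intro v w
      change (2⁻¹ : ℂ) • ∑ i : Fin (2 * m), wedge (e i.rev) (bivectorEnd m (wedge v w) (e i))
        = wedge v w
      have h : ∀ a b : V m, ∑ i : Fin (2 * m), wedge (e i.rev) (form m a (e i) • b) = wedge a b := by
        intro a b
        conv_rhs => rw [← sum_form_smul a, ← wedgeₗ_apply, map_sum, LinearMap.sum_apply]
        simp [← wedgeₗ_apply]
      simp only [bivectorEnd_wedge]
      simp only [← wedgeₗ_apply, map_sub, Finset.sum_sub_distrib]
      simp only [wedgeₗ_apply, h]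
      rw [wedge_swap w v, sub_neg_eq_add, ← two_smul ℂ, smul_smul]
      norm_num)

theorem bivectorEquiv_wedge {m : ℕ} (v w u : V m) :
    (bivectorEquiv m (wedge v w)).1 u = form m v u • w - form m w u • v :=
  bivectorEnd_wedge v w u

/-- The identification `⋀² ℂ^{2m} = so_{2m}` is equivariant. -/
theorem lie_bivectorEquiv_wedge {m : ℕ} (X : so m) (v w : V m) :
    ⁅X, bivectorEquiv m (wedge v w)⁆ =
      bivectorEquiv m (wedge (X.1 v) w) + bivectorEquiv m (wedge v (X.1 w)) := by
  have hX := (mem_so_iff X.1).1 X.2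
  apply Subtype.ext
  refine LinearMap.ext fun u => ?_
  simp only [LieSubalgebra.coe_bracket, Ring.lie_def, LinearMap.sub_apply, Module.End.mul_apply,
    AddMemClass.coe_add, LinearMap.add_apply, bivectorEquiv_wedge, map_sub, map_smul, hX, neg_smul]
  abel

/-- The highest root is the weight of the root vector `e₁ ∧ e₂`, which is killed by `𝔫`. -/
theorem highestRoot_spec (m : ℕ) (hm : 4 ≤ m) :
    HasHighestWeightVector m (so m) (highestRoot m hm) := by
  have h0 : 0 < 2 * m := by omega
  have h1 : 1 < 2 * m := by omega
  refine ⟨bivectorEquiv m (wedge (e ⟨0, h0⟩) (e ⟨1, h1⟩)), ?_, ?_, ?_⟩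
  · intro h
    have := congrArg (fun X : so m => X.1 (e (Fin.rev ⟨0, h0⟩)) ⟨1, h1⟩) h
    simp [bivectorEquiv_wedge, form_e_e] at this
  · intro H
    have hd : ∀ j, (H : so m).1 (e j) = entry (H : so m) j j • e j := by
      intro j
      ext i
      rw [← entry_eq]
      by_cases hij : i = j
      · subst hij; simp
      · rw [H.2 i j hij]; simp [hij]
    rw [lie_bivectorEquiv_wedge, hd, hd, ← map_add, ← wedgeₗ_apply, ← wedgeₗ_apply, map_smul,
      map_smul, LinearMap.smul_apply, ← add_smul, map_smul]
    rfl
  · intro X hX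
    have z0 : X.1 (e ⟨0, h0⟩) = 0 := by
      ext i
      rw [← entry_eq, hX i _ (Fin.mk_le_of_le_val (Nat.zero_le _))]; rfl
    have z1 : X.1 (e ⟨1, h1⟩) = entry X ⟨0, h0⟩ ⟨1, h1⟩ • e ⟨0, h0⟩ := by
      ext i
      rw [← entry_eq]
      by_cases hi : i = ⟨0, h0⟩
      · subst hi; simp
      · rw [hX i _ (by
          have : i.1 ≠ 0 := fun h => hi (Fin.ext h)
          exact Fin.mk_le_of_le_val (by omega))]
        simp [hi]
    have hs : wedge (e ⟨0, h0⟩ : V m) (e ⟨0, h0⟩) = 0 := by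
      apply Subtype.ext
      rw [coe_wedge, ExteriorAlgebra.ι_sq_zero]
      rfl
    rw [lie_bivectorEquiv_wedge, z0, z1, ← wedgeₗ_apply, ← wedgeₗ_apply, map_smul, wedgeₗ_apply, wedgeₗ_apply, hs]
    simp [← wedgeₗ_apply]

/-! ### Quadratic functions as a representation -/

section QuadraticAction

variable {R L M : Type*} [CommRing R] [LieRing L] [LieAlgebra R L] [AddCommGroup M] [Module R M]
  [LieRingModule L M] [LieModule R L M]

/-- The quadratic form `X · q`, with `(X · q)(y) = - polar q (y, X · y)`; this is the derivative at
`t = 0` of `q (exp (-t X) y)`. -/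
def quadLie (X : L) (q : QuadraticForm R M) : QuadraticForm R M :=
  - LinearMap.BilinMap.toQuadraticMap (q.polarBilin.compl₂ (LieModule.toEnd R L M X))

theorem quadLie_apply (X : L) (q : QuadraticForm R M) (y : M) :
    quadLie X q y = - QuadraticMap.polar q y ⁅X, y⁆ := rfl

theorem polar_quadLie (X : L) (q : QuadraticForm R M) (y z : M) :
    QuadraticMap.polar (quadLie X q) y z =
      - (QuadraticMap.polar q y ⁅X, z⁆ + QuadraticMap.polar q z ⁅X, y⁆) := by
  rw [QuadraticMap.polar, quadLie_apply, quadLie_apply, quadLie_apply]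
  simp only [lie_add, QuadraticMap.polar_add_left, QuadraticMap.polar_add_right]
  ring

/-- The space of quadratic forms on a representation `M`, i.e. `Sym² (M^*)`, is a representation. -/
instance quadLieRingModule : LieRingModule L (QuadraticForm R M) where
  bracket := quadLie
  add_lie X Y q := by
    ext y
    simp [quadLie_apply, QuadraticMap.polar_add_right, add_comm]
  lie_add X q r := by
    ext y
    simp [quadLie_apply, QuadraticMap.polar_add, add_comm]
  leibniz_lie X Y q := by
    ext y
    rw [_root_.add_apply, quadLie_apply, quadLie_apply, quadLie_apply, polar_quadLie,
      polar_quadLie, lie_lie, QuadraticMap.polar_sub_right,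
      QuadraticMap.polar_comm q ⁅Y, y⁆]
    ring

theorem lie_quad_apply (X : L) (q : QuadraticForm R M) (y : M) :
    ⁅X, q⁆ y = - QuadraticMap.polar q y ⁅X, y⁆ := rfl

instance quadLieModule : LieModule R L (QuadraticForm R M) where
  smul_lie c X q := by
    ext y
    simp [lie_quad_apply, QuadraticMap.polar_smul_right]
  lie_smul c X q := by
    ext y
    simp [lie_quad_apply, QuadraticMap.polar_smul]

end QuadraticAction

/-! ### The maps `Φ` and `Ψ` -/

/-- The exterior product `⋀² × ⋀² → ⋀⁴`. -/
def wedge₂₂ (m : ℕ) : LinearMap.BilinMap ℂ (⋀[ℂ]^2 (V m)) (⋀[ℂ]^4 (V m)) :=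
  LinearMap.mk₂ ℂ
    (fun α β => ⟨(α : ExteriorAlgebra ℂ (V m)) * (β : ExteriorAlgebra ℂ (V m)), by
      have := Submodule.mul_mem_mul α.2 β.2
      rwa [← pow_add] at this⟩)
    (by intros; apply Subtype.ext; simp [add_mul])
    (by intros; apply Subtype.ext; simp)
    (by intros; apply Subtype.ext; simp [mul_add])
    (by intros; apply Subtype.ext; simp)

/-- `Φ : (⋀⁴ ℂ^{2m})^* → ℂ[⋀² ℂ^{2m}]`, `φ ↦ (α ↦ φ(α ∧ α))`; its values are quadratic forms. -/
def Phi (m : ℕ) : Dual ℂ (⋀[ℂ]^4 (V m)) →ₗ[ℂ] QuadraticForm ℂ (⋀[ℂ]^2 (V m)) where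
  toFun φ := LinearMap.BilinMap.toQuadraticMap ((wedge₂₂ m).compr₂ φ)
  map_add' φ χ := by ext; simp
  map_smul' c φ := by ext; simp

theorem Phi_apply {m : ℕ} (φ : Dual ℂ (⋀[ℂ]^4 (V m))) (α : ⋀[ℂ]^2 (V m)) :
    Phi m φ α = φ (wedge₂₂ m α α) := rfl

/-- The linear map out of a symmetric power induced by a symmetric multilinear map. -/
def symLift {R ι : Type} {M N : Type*} [CommSemiring R] [AddCommMonoid M] [Module R M]
    [AddCommMonoid N] [Module R N] (f : MultilinearMap R (fun _ : ι => M) N)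
    (hf : ∀ (σ : Equiv.Perm ι) (a : ι → M), f (fun i => a (σ i)) = f a) :
    SymmetricPower R ι M →ₗ[R] N where
  toFun := AddCon.lift (addConGen (SymmetricPower.Rel R ι M))
    (PiTensorProduct.lift f).toAddMonoidHom
    (AddCon.addConGen_le.2 fun x y h => by
      cases h with
      | perm σ a => simpa [AddCon.ker_rel] using (hf σ a).symm)
  map_add' := map_add _
  map_smul' c x := by
    induction x using AddCon.induction_on with
    | H x => exact map_smul (PiTensorProduct.lift f) c x

theorem symLift_tprod {R ι : Type} {M N : Type*} [CommSemiring R] [AddCommMonoid M] [Module R M]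
    [AddCommMonoid N] [Module R N] (f : MultilinearMap R (fun _ : ι => M) N)
    (hf : ∀ (σ : Equiv.Perm ι) (a : ι → M), f (fun i => a (σ i)) = f a) (a : ι → M) :
    symLift f hf (SymmetricPower.tprod R a) = f a :=
  PiTensorProduct.lift.tprod a

/-- `(f, g) ↦ (α ↦ (ι_f α, ι_g α))` as a multilinear map on pairs of covectors. -/
def psiMultilinear (m : ℕ) :
    MultilinearMap ℂ (fun _ : Fin 2 => Dual ℂ (V m)) (QuadraticForm ℂ (⋀[ℂ]^2 (V m))) :=
  MultilinearMap.mk'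
    (fun a => LinearMap.BilinMap.toQuadraticMap
      ((form m).compl₁₂ (contract m (a 0)) (contract m (a 1))))
    (by
      intro a i x y
      ext α
      fin_cases i <;> simp)
    (by
      intro a i c x
      ext α
      fin_cases i <;> simp)

theorem psiMultilinear_apply {m : ℕ} (a : Fin 2 → Dual ℂ (V m)) (α : ⋀[ℂ]^2 (V m)) :
    psiMultilinear m a α = form m (contract m (a 0) α) (contract m (a 1) α) := rfl

theorem psiMultilinear_symm {m : ℕ} (σ : Equiv.Perm (Fin 2)) (a : Fin 2 → Dual ℂ (V m)) :
    psiMultilinear m (fun i => a (σ i)) = psiMultilinear m a := by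
  refine QuadraticMap.ext fun α => ?_
  rw [psiMultilinear_apply, psiMultilinear_apply]
  fin_cases σ
  · rfl
  · exact form_comm _ _

/-- `Ψ : Sym² (ℂ^{2m})^* → ℂ[⋀² ℂ^{2m}]`, `f · g ↦ (α ↦ (ι_f α, ι_g α))`; its values are quadratic
forms. -/
def Psi (m : ℕ) : Sym[ℂ]^2 (Dual ℂ (V m)) →ₗ[ℂ] QuadraticForm ℂ (⋀[ℂ]^2 (V m)) :=
  symLift (psiMultilinear m) psiMultilinear_symm

theorem Psi_apply {m : ℕ} (f g : Dual ℂ (V m)) (α : ⋀[ℂ]^2 (V m)) :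
    Psi m (SymmetricPower.tprod ℂ ![f, g]) α = form m (contract m f α) (contract m g α) := by
  rw [Psi, symLift_tprod, psiMultilinear_apply]
  rfl

/-- Transport of quadratic forms along `⋀² ℂ^{2m} = so_{2m}`. -/
def transport (m : ℕ) : QuadraticForm ℂ (⋀[ℂ]^2 (V m)) →ₗ[ℂ] QuadraticForm ℂ (so m) where
  toFun q := q.comp (bivectorEquiv m).symm.toLinearMap
  map_add' _ _ := rfl
  map_smul' _ _ := rfl

/-- `V_dec`, the image of `Φ`, as a space of quadratic forms on `so_{2m} = ⋀² ℂ^{2m}`. -/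
def Vdec (m : ℕ) : Submodule ℂ (QuadraticForm ℂ (so m)) := (LinearMap.range (Phi m)).map (transport m)

/-- `V_iso`, the image of `Ψ`, as a space of quadratic forms on `so_{2m} = ⋀² ℂ^{2m}`. -/
def Viso (m : ℕ) : Submodule ℂ (QuadraticForm ℂ (so m)) := (LinearMap.range (Psi m)).map (transport m)

end SOQuad

end

noncomputable section

namespace SOQuad

variable {m : ℕ}

/-! ### Bivectors as elements of `so_{2m}` and curvature components of quadratic forms -/

/-! Polarising a quadratic form `q` on `so m` gives a 4-tensor `curv q` with the symmetries of a
Riemann curvature tensor, except possibly the first Bianchi identity. The splitting is the classical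
one. The Bianchi sum is always alternating, and alternating tensors are exactly `Vdec`, the forms
vanishing on decomposable bivectors. The Kulkarni–Nomizu products of a symmetric `h` with the
invariant form are exactly `Viso`; their Ricci contraction is `(2m-2) h + (tr h) form`, which
determines `h` and takes every symmetric value. What remains is `weyl m`, the forms with zero
Bianchi sum and zero Ricci contraction. Alternating tensors have no Ricci part and Kulkarni–Nomizu
products have no Bianchi part, so the two projections do not interfere.

Irreducibility of `weyl m` is proved without character theory. Fix a plane spanned by isotropic,
orthogonal `a`, `b`. If every form in a subrepresentation `N ≤ weyl m` vanished at `a ∧ b`,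
transvections `exp X` with `X² = 0` would carry this to all isotropic planes
(`vanishAt_of_isotropic`), and a Weyl-type form vanishing there is zero (`weyl_eq_zero`). So a
nonzero `N` contains `q` with `q (a ∧ b) ≠ 0`, and applying `a ∧ b` four times to `q` yields a
nonzero multiple of `sqForm (a ∧ b)` (`lie_pow_four`). The orthogonal complement of `N` in `weyl m`
for the invariant trace pairing would, if nonzero, contain `sqForm (a ∧ b)` too; but pairing this
with `q` gives `4 q (a ∧ b) ≠ 0`. So the complement is zero and `N = weyl m` by dimension.

Evaluation at `e₁ ∧ e₂` is a highest weight vector of weight `2ψ` in the dual of `weyl m`.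
Irreducible modules with the same highest weight are isomorphic by the usual graph argument
(`nonempty_equiv_of_highestWeight`), and dualising identifies `weyl m` with the dual of any model of
`V_{2ψ}`. -/

/-- The element `v ∧ w` of `so_{2m}`, as a bilinear map. -/
def bv (m : ℕ) : V m →ₗ[ℂ] V m →ₗ[ℂ] so m :=
  (wedgeₗ m).compr₂ (bivectorEquiv m).toLinearMap

theorem bv_eq (v w : V m) : bv m v w = bivectorEquiv m (wedge v w) := rfl

theorem bv_apply (v w u : V m) : (bv m v w).1 u = form m v u • w - form m w u • v :=
  bivectorEquiv_wedge v w u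

theorem bv_swap (v w : V m) : bv m v w = - bv m w v := by
  rw [bv_eq, wedge_swap, map_neg, bv_eq]

theorem bv_self (v : V m) : bv m v v = 0 :=
  Subtype.ext (LinearMap.ext fun u => by rw [bv_apply, sub_self]; rfl)

theorem lie_bv (X : so m) (v w : V m) : ⁅X, bv m v w⁆ = bv m (X.1 v) w + bv m v (X.1 w) :=
  lie_bivectorEquiv_wedge X v w

theorem so_skew (X : so m) (v w : V m) : form m (X.1 v) w = - form m v (X.1 w) :=
  (mem_so_iff X.1).1 X.2 v w

theorem so_linearMap_ext {N : Type*} [AddCommGroup N] [Module ℂ N] {f g : so m →ₗ[ℂ] N}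
    (h : ∀ v w, f (bv m v w) = g (bv m v w)) : f = g := by
  have : f ∘ₗ (bivectorEquiv m).toLinearMap = g ∘ₗ (bivectorEquiv m).toLinearMap := wedge_ext h
  ext X
  simpa using LinearMap.congr_fun this ((bivectorEquiv m).symm X)

theorem so_induction {p : so m → Prop} (h0 : p 0) (hadd : ∀ X Y, p X → p Y → p (X + Y))
    (hsmul : ∀ (c : ℂ) X, p X → p (c • X)) (hbv : ∀ i j, p (bv m (e i) (e j))) (X : so m) :
    p X := by
  let S : Submodule ℂ (so m) :=
    { carrier := {X | p X}
      add_mem' := fun {a b} ha hb => hadd a b ha hb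
      zero_mem' := h0
      smul_mem' := fun c {x} hx => hsmul c x hx }
  have hS : S.mkQ = 0 := by
    apply so_linearMap_ext
    intro v w
    simp only [LinearMap.zero_apply, Submodule.mkQ_apply, Submodule.Quotient.mk_eq_zero]
    rw [← sum_smul_e v, ← sum_smul_e w]
    simp only [map_sum, LinearMap.sum_apply, map_smul, LinearMap.smul_apply]
    exact S.sum_mem fun i _ => S.smul_mem _ (S.sum_mem fun j _ => S.smul_mem _ (hbv _ _))
  have := LinearMap.congr_fun hS X
  rwa [Submodule.mkQ_apply, LinearMap.zero_apply, Submodule.Quotient.mk_eq_zero] at this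

/-- The components of (the polar form of) a quadratic form on `so_{2m}`. -/
def curv (q : QuadraticForm ℂ (so m)) (u v x y : V m) : ℂ :=
  q.polarBilin (bv m u v) (bv m x y)

theorem curv_symm (q : QuadraticForm ℂ (so m)) (u v x y : V m) :
    curv q u v x y = curv q x y u v := QuadraticMap.polar_comm _ _ _

theorem curv_swap_left (q : QuadraticForm ℂ (so m)) (u v x y : V m) :
    curv q u v x y = - curv q v u x y := by
  simp only [curv, bv_swap u v, map_neg, LinearMap.neg_apply]

theorem curv_swap_right (q : QuadraticForm ℂ (so m)) (u v x y : V m) :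
    curv q u v x y = - curv q u v y x := by
  simp only [curv, bv_swap x y, map_neg]

theorem curv_self (q : QuadraticForm ℂ (so m)) (u v : V m) :
    curv q u v u v = 2 * q (bv m u v) := by
  simp [curv, QuadraticMap.polar_self]

theorem curv_lie (X : so m) (q : QuadraticForm ℂ (so m)) (u v x y : V m) :
    curv ⁅X, q⁆ u v x y = - (curv q (X.1 u) v x y + curv q u (X.1 v) x y +
      curv q u v (X.1 x) y + curv q u v x (X.1 y)) := by
  have h : curv ⁅X, q⁆ u v x y = - (QuadraticMap.polar q (bv m u v) ⁅X, bv m x y⁆ +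
      QuadraticMap.polar q (bv m x y) ⁅X, bv m u v⁆) := polar_quadLie X q _ _
  rw [h, lie_bv, lie_bv, QuadraticMap.polar_add_right, QuadraticMap.polar_add_right]
  rw [QuadraticMap.polar_comm q (bv m x y), QuadraticMap.polar_comm q (bv m x y)]
  simp only [curv, QuadraticMap.polarBilin_apply_apply]
  ring

theorem curv_add (q r : QuadraticForm ℂ (so m)) (u v x y : V m) :
    curv (q + r) u v x y = curv q u v x y + curv r u v x y := by
  simp [curv, QuadraticMap.polar_add]

theorem curv_smul (c : ℂ) (q : QuadraticForm ℂ (so m)) (u v x y : V m) :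
    curv (c • q) u v x y = c * curv q u v x y := by
  simp [curv, QuadraticMap.polar_smul]

theorem curv_sub (q r : QuadraticForm ℂ (so m)) (u v x y : V m) :
    curv (q - r) u v x y = curv q u v x y - curv r u v x y := by
  rw [sub_eq_add_neg, ← neg_one_smul ℂ r, curv_add, curv_smul]; ring

theorem curv_zero (u v x y : V m) : curv (0 : QuadraticForm ℂ (so m)) u v x y = 0 := by
  simpa using curv_smul (0 : ℂ) 0 u v x y

theorem curv_ext {q r : QuadraticForm ℂ (so m)}
    (h : ∀ u v x y, curv q u v x y = curv r u v x y) : q = r := by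
  have : q.polarBilin = r.polarBilin := by
    apply so_linearMap_ext
    intro u v
    apply so_linearMap_ext
    intro x y
    exact h u v x y
  ext X
  have h2 := LinearMap.congr_fun₂ this X X
  simp only [QuadraticMap.polarBilin_apply_apply, QuadraticMap.polar_self] at h2
  simpa using h2

theorem eq_zero_of_curv {q : QuadraticForm ℂ (so m)} (h : ∀ u v x y, curv q u v x y = 0) :
    q = 0 := curv_ext fun u v x y => by rw [h, curv_zero]

/-! ### Contractions -/

/-- The contraction of a bilinear map with the inverse of the form. -/
theorem sum_lie_contract {N : Type*} [AddCommGroup N] [Module ℂ N] (B : V m →ₗ[ℂ] V m →ₗ[ℂ] N)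
    (X : so m) :
    ∑ k, B (X.1 (e k)) (e k.rev) + ∑ k, B (e k) (X.1 (e k.rev)) = 0 := by
  have h1 : ∀ k : Fin (2 * m), B (X.1 (e k)) (e k.rev) =
      ∑ j : Fin (2 * m), form m (X.1 (e k)) (e j) • B (e j.rev) (e k.rev) := by
    intro k
    conv_lhs => rw [← sum_form_smul (X.1 (e k))]
    simp
  have h2 : ∀ k : Fin (2 * m), B (e k) (X.1 (e k.rev)) =
      ∑ j : Fin (2 * m), form m (X.1 (e k.rev)) (e j) • B (e k) (e j.rev) := by
    intro k
    conv_lhs => rw [← sum_form_smul (X.1 (e k.rev))]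
    simp
  simp only [h1, h2]
  have h3 : ∑ k : Fin (2 * m), ∑ j : Fin (2 * m), form m (X.1 (e k.rev)) (e j) • B (e k) (e j.rev)
      = ∑ k : Fin (2 * m), ∑ j : Fin (2 * m), form m (X.1 (e k)) (e j) • B (e k.rev) (e j.rev) := by
    rw [← Equiv.sum_comp Fin.revPerm]
    simp
  -- Both double sums now run over the same values of `B`; their coefficients `(X e_k, e_j)` and `(X
  -- e_j, e_k)` are opposite because `X` is skew.
  rw [h3, Finset.sum_comm, ← Finset.sum_add_distrib]
  refine Finset.sum_eq_zero fun k _ => ?_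
  rw [← Finset.sum_add_distrib]
  refine Finset.sum_eq_zero fun j _ => ?_
  rw [so_skew, form_comm, neg_smul, neg_add_cancel]

theorem sum_contract_form_left {N : Type*} [AddCommGroup N] [Module ℂ N] (f : V m →ₗ[ℂ] N)
    (v : V m) : ∑ k : Fin (2 * m), form m v (e k) • f (e k.rev) = f v := by
  conv_rhs => rw [← sum_form_smul v]
  simp

theorem sum_contract_form_right {N : Type*} [AddCommGroup N] [Module ℂ N] (f : V m →ₗ[ℂ] N)
    (v : V m) : ∑ k : Fin (2 * m), form m v (e k.rev) • f (e k) = f v := by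
  rw [← sum_contract_form_left f v, ← Equiv.sum_comp Fin.revPerm]
  simp

/-- The Ricci contraction. -/
def ric (q : QuadraticForm ℂ (so m)) (x y : V m) : ℂ :=
  ∑ k : Fin (2 * m), curv q x (e k) y (e k.rev)

theorem ric_lie (X : so m) (q : QuadraticForm ℂ (so m)) (x y : V m) :
    ric ⁅X, q⁆ x y = - (ric q (X.1 x) y + ric q x (X.1 y)) := by
  have := sum_lie_contract
    ((q.polarBilin.compl₁₂ (bv m x) (bv m y)) : V m →ₗ[ℂ] V m →ₗ[ℂ] ℂ) X
  simp only [LinearMap.compl₁₂_apply] at this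
  simp only [ric, curv_lie, Finset.sum_neg_distrib, Finset.sum_add_distrib]
  simp only [curv]
  linear_combination -this

theorem ric_add (q r : QuadraticForm ℂ (so m)) (x y : V m) :
    ric (q + r) x y = ric q x y + ric r x y := by
  simp [ric, curv_add, Finset.sum_add_distrib]

theorem ric_smul (c : ℂ) (q : QuadraticForm ℂ (so m)) (x y : V m) :
    ric (c • q) x y = c * ric q x y := by
  simp [ric, curv_smul, Finset.mul_sum]

theorem ric_zero (x y : V m) : ric (0 : QuadraticForm ℂ (so m)) x y = 0 := by
  simp [ric, curv_zero]

/-- The Bianchi sum. -/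
def bianchi (q : QuadraticForm ℂ (so m)) (u v x y : V m) : ℂ :=
  curv q u v x y + curv q v x u y + curv q x u v y

theorem bianchi_lie (X : so m) (q : QuadraticForm ℂ (so m)) (u v x y : V m) :
    bianchi ⁅X, q⁆ u v x y = - (bianchi q (X.1 u) v x y + bianchi q u (X.1 v) x y +
      bianchi q u v (X.1 x) y + bianchi q u v x (X.1 y)) := by
  simp only [bianchi, curv_lie]
  ring

theorem bianchi_add (q r : QuadraticForm ℂ (so m)) (u v x y : V m) :
    bianchi (q + r) u v x y = bianchi q u v x y + bianchi r u v x y := by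
  simp only [bianchi, curv_add]; ring

theorem bianchi_smul (c : ℂ) (q : QuadraticForm ℂ (so m)) (u v x y : V m) :
    bianchi (c • q) u v x y = c * bianchi q u v x y := by
  simp only [bianchi, curv_smul]; ring

theorem bianchi_zero (u v x y : V m) : bianchi (0 : QuadraticForm ℂ (so m)) u v x y = 0 := by
  simp [bianchi, curv_zero]

/-- The quadratic forms of Weyl type: those satisfying the Bianchi identity with vanishing Ricci
contraction. -/
def weyl (m : ℕ) : LieSubmodule ℂ (so m) (QuadraticForm ℂ (so m)) where
  carrier := {q | (∀ u v x y, bianchi q u v x y = 0) ∧ ∀ x y, ric q x y = 0}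
  add_mem' := fun {q r} hq hr => ⟨fun u v x y => by rw [bianchi_add, hq.1, hr.1, add_zero],
    fun x y => by rw [ric_add, hq.2, hr.2, add_zero]⟩
  zero_mem' := ⟨bianchi_zero, ric_zero⟩
  smul_mem' := fun c {q} hq => ⟨fun u v x y => by rw [bianchi_smul, hq.1, mul_zero],
    fun x y => by rw [ric_smul, hq.2, mul_zero]⟩
  lie_mem := fun {X q} hq => by
    refine ⟨fun u v x y => ?_, fun x y => ?_⟩
    · rw [bianchi_lie]
      simp [hq.1]
    · rw [ric_lie]
      simp [hq.2]

/-! ### Decomposable part -/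

theorem transport_apply_bv (q : QuadraticForm ℂ (⋀[ℂ]^2 (V m))) (u v : V m) :
    transport m q (bv m u v) = q (wedge u v) := by
  change q ((bivectorEquiv m).symm (bivectorEquiv m (wedge u v))) = _
  rw [LinearEquiv.symm_apply_apply]

theorem curv_transport (q : QuadraticForm ℂ (⋀[ℂ]^2 (V m))) (u v x y : V m) :
    curv (transport m q) u v x y = QuadraticMap.polar q (wedge u v) (wedge x y) := by
  have h : transport m q (bv m u v + bv m x y) = q (wedge u v + wedge x y) := by
    change q ((bivectorEquiv m).symm (bivectorEquiv m (wedge u v) + bivectorEquiv m (wedge x y)))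
      = _
    rw [← map_add, LinearEquiv.symm_apply_apply]
  change transport m q (bv m u v + bv m x y) - transport m q _ - transport m q _ = _
  rw [h, transport_apply_bv, transport_apply_bv]
  rfl

theorem wedge₂₂_wedge (u v x y : V m) :
    wedge₂₂ m (wedge u v) (wedge x y) = exteriorPower.ιMulti ℂ 4 ![u, v, x, y] := by
  apply Subtype.ext
  change (wedge u v : ExteriorAlgebra ℂ (V m)) * (wedge x y : ExteriorAlgebra ℂ (V m)) = _
  rw [coe_wedge, coe_wedge]
  simp [ExteriorAlgebra.ιMulti_apply, mul_assoc]

theorem curv_transport_Phi (φ : Dual ℂ (⋀[ℂ]^4 (V m))) (u v x y : V m) :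
    curv (transport m (Phi m φ)) u v x y =
      2 * φ (exteriorPower.ιMulti ℂ 4 ![u, v, x, y]) := by
  have h : exteriorPower.ιMulti ℂ 4 ![x, y, u, v] = exteriorPower.ιMulti ℂ 4 ![u, v, x, y] := by
    apply Subtype.ext
    have hc : ∀ a b : V m, ExteriorAlgebra.ι ℂ a * ExteriorAlgebra.ι ℂ b =
        - (ExteriorAlgebra.ι ℂ b * ExteriorAlgebra.ι ℂ a) :=
      fun a b => eq_neg_of_add_eq_zero_left (ExteriorAlgebra.ι_add_mul_swap a b)
    simp only [exteriorPower.ιMulti_apply_coe, ExteriorAlgebra.ιMulti_apply, List.ofFn_succ,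
      List.ofFn_zero, List.prod_cons, List.prod_nil, mul_one]
    simp only [Matrix.cons_val_zero, Matrix.cons_val_succ]
    rw [← mul_assoc _ (ExteriorAlgebra.ι ℂ u), hc y u, neg_mul, mul_neg,
      mul_assoc (_ : ExteriorAlgebra ℂ (V m)) _ (_),
      hc y v]
    simp only [mul_neg, neg_neg, ← mul_assoc]
    rw [hc x u, mul_assoc (ExteriorAlgebra.ι ℂ u * _), neg_mul, neg_mul,
      mul_assoc (ExteriorAlgebra.ι ℂ u), ← mul_assoc _ _ (ExteriorAlgebra.ι ℂ y),
      hc x v]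
    simp [mul_assoc]
  rw [curv_transport, QuadraticMap.polar, Phi_apply, Phi_apply, Phi_apply]
  simp only [map_add, LinearMap.add_apply, wedge₂₂_wedge, h]
  ring

theorem eq_zero_of_ιMulti {φ : Dual ℂ (⋀[ℂ]^4 (V m))}
    (h : ∀ u v x y : V m, φ (exteriorPower.ιMulti ℂ 4 ![u, v, x, y]) = 0) : φ = 0 := by
  apply exteriorPower.linearMap_ext
  ext a
  have ha : a = ![a 0, a 1, a 2, a 3] := by ext i : 1; fin_cases i <;> rfl
  rw [ha]
  exact h _ _ _ _

theorem Phi_injective : Function.Injective (Phi m) := by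
  rw [injective_iff_map_eq_zero]
  intro φ hφ
  refine eq_zero_of_ιMulti fun u v x y => ?_
  have := curv_transport_Phi φ u v x y
  rw [hφ, map_zero, curv_zero] at this
  simpa using this

/-- The Bianchi sum as an alternating form. -/
def bianchiAlt (q : QuadraticForm ℂ (so m)) : V m [⋀^Fin 4]→ₗ[ℂ] ℂ where
  toMultilinearMap := MultilinearMap.mk' (fun a => bianchi q (a 0) (a 1) (a 2) (a 3))
    (by
      intro a i x y
      fin_cases i <;>
      · simp [bianchi, curv, Function.update]
        try ring)
    (by
      intro a i c x
      fin_cases i <;>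
      · simp [bianchi, curv, Function.update]
        try ring)
  map_eq_zero_of_eq' := by
    have h1 : ∀ u x y, bianchi q u u x y = 0 := by
      intro u x y
      simp only [bianchi]
      rw [curv_swap_left q x u]
      simp [curv, bv_self]
    have h2 : ∀ u v x y, bianchi q u v x y = - bianchi q v u x y := by
      intro u v x y
      simp only [bianchi]
      rw [curv_swap_left q u v, curv_swap_left q v x, curv_swap_left q x u]
      ring
    have h3 : ∀ u v x y, bianchi q u v x y = bianchi q v x u y := by
      intro u v x y
      simp only [bianchi]
      ring
    -- Only this coincidence uses the pair symmetry of `curv`; the remaining ones reduce to it and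
    -- to `h1` by cyclic rotation and the swap `h2`.
    have h4 : ∀ u v x, bianchi q u v x x = 0 := by
      intro u v x
      have a : curv q u v x x = 0 := by simp [curv, bv_self]
      have b := curv_symm q v x u x
      have c := curv_swap_left q u x v x
      simp only [bianchi]
      linear_combination a + b + c
    have h5 : ∀ u v y, bianchi q u v u y = 0 := fun u v y => by
      rw [h3, h3, h1]
    have h6 : ∀ u v y, bianchi q u v v y = 0 := fun u v y => by
      rw [h3, h1]
    have h7 : ∀ u v y, bianchi q u v y u = 0 := fun u v y => by
      rw [h3, h4]
    have h8 : ∀ u v y, bianchi q u v y v = 0 := fun u v y => by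
      rw [h2, h7, neg_zero]
    intro a i j hij hne
    change bianchi q (a 0) (a 1) (a 2) (a 3) = 0
    fin_cases i <;> fin_cases j <;> simp at hne hij <;> simp [hij, h1, h4, h5, h6, h7, h8]

theorem bianchiAlt_apply (q : QuadraticForm ℂ (so m)) (u v x y : V m) :
    bianchiAlt q ![u, v, x, y] = bianchi q u v x y := rfl

/-- The element of `V_dec` attached to the Bianchi sum of a quadratic form. -/
def decPart (q : QuadraticForm ℂ (so m)) : QuadraticForm ℂ (so m) :=
  -- `Phi` followed by polarisation doubles, and the Bianchi sum of an alternating tensor is three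
  -- times the tensor; the factor 1/6 therefore preserves the Bianchi sum.
  transport m (Phi m ((6⁻¹ : ℂ) • exteriorPower.alternatingMapLinearEquiv (bianchiAlt q)))

theorem decPart_mem (q : QuadraticForm ℂ (so m)) : decPart q ∈ Vdec m :=
  Submodule.mem_map_of_mem (LinearMap.mem_range_self _ _)

theorem curv_decPart (q : QuadraticForm ℂ (so m)) (u v x y : V m) :
    curv (decPart q) u v x y = 3⁻¹ * bianchi q u v x y := by
  rw [decPart, curv_transport_Phi, LinearMap.smul_apply,
    exteriorPower.alternatingMapLinearEquiv_apply_ιMulti, bianchiAlt_apply, smul_eq_mul]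
  ring

theorem bianchi_cyclic (q : QuadraticForm ℂ (so m)) (u v x y : V m) :
    bianchi q v x u y = bianchi q u v x y := by
  simp only [bianchi]
  ring

theorem bianchi_decPart (q : QuadraticForm ℂ (so m)) (u v x y : V m) :
    bianchi (decPart q) u v x y = bianchi q u v x y := by
  have h1 := bianchi_cyclic q u v x y
  have h2 := bianchi_cyclic q v x u y
  rw [bianchi, curv_decPart, curv_decPart, curv_decPart]
  linear_combination (2 / 3) * h1 + (1 / 3) * h2

/-- Quadratic forms vanishing on decomposable bivectors have alternating components. -/
theorem curv_left_alternating {q : QuadraticForm ℂ (so m)} (h : ∀ u v, q (bv m u v) = 0)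
    (u v x y : V m) : curv q u v x y = - curv q x v u y ∧ curv q u v u y = 0 := by
  have h1 : ∀ u v y, curv q u v u y = 0 := by
    intro u v y
    -- Polarise `q (u ∧ v) = 0` in `v`; polarising the result in `u` gives the other half.
    have a := curv_self q u (v + y)
    have b := curv_self q u v
    have c := curv_self q u y
    rw [h] at a b c
    have d := curv_symm q u v u y
    simp only [curv, map_add, LinearMap.add_apply] at a b c d ⊢
    linear_combination (a - b - c + d) / 2
  refine ⟨?_, h1 u v y⟩
  have a := h1 (u + x) v y
  have b := h1 u v y
  have c := h1 x v y
  simp only [curv, map_add, LinearMap.add_apply] at a b c ⊢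
  linear_combination a - b - c

/-- Vanishing on decomposables makes `curv q` totally alternating, and a cyclic rotation of three
arguments is even, so the three terms agree. -/
theorem bianchi_of_vanishing {q : QuadraticForm ℂ (so m)} (h : ∀ u v, q (bv m u v) = 0)
    (u v x y : V m) : bianchi q u v x y = 3 * curv q u v x y := by
  have h1 := (curv_left_alternating h v x u y).1
  have h2 := (curv_left_alternating h x u v y).1
  have h3 := curv_swap_left q u x v y
  have h4 := curv_swap_left q v u x y
  rw [bianchi]
  linear_combination h1 + 2 * h2 - h3 - 2 * h4

/-- The forms cutting out the decomposable bivectors are the Plücker quadrics: such a form has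
alternating components, hence equals its own `decPart`. -/
theorem mem_Vdec {q : QuadraticForm ℂ (so m)} : q ∈ Vdec m ↔ ∀ u v, q (bv m u v) = 0 := by
  constructor
  · rintro ⟨_, ⟨φ, rfl⟩, rfl⟩ u v
    rw [transport_apply_bv, Phi_apply, wedge₂₂_wedge]
    rw [(exteriorPower.ιMulti ℂ 4).map_eq_zero_of_eq ![u, v, u, v] (i := 0) (j := 2) rfl (by decide),
      map_zero]
  · intro h
    have : q = decPart q := by
      refine curv_ext fun u v x y => ?_
      rw [curv_decPart, bianchi_of_vanishing h]
      ring
    rw [this]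
    exact decPart_mem q

/-- Contracting an alternating tensor with the symmetric inverse form gives zero: exchanging `k` and
`k.rev` changes the sign of the sum. -/
theorem ric_eq_zero_of_mem_Vdec {q : QuadraticForm ℂ (so m)} (h : q ∈ Vdec m) (x y : V m) :
    ric q x y = 0 := by
  rw [mem_Vdec] at h
  have : ∀ k : Fin (2 * m), curv q x (e k) y (e k.rev) = - curv q x (e k.rev) y (e k) := by
    intro k
    rw [(curv_left_alternating h x (e k) y (e k.rev)).1, curv_symm]
  have h2 : ric q x y = - ric q x y := by
    conv_lhs => rw [ric, Finset.sum_congr rfl fun k _ => this k]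
    rw [Finset.sum_neg_distrib, ric, ← Equiv.sum_comp Fin.revPerm]
    simp
  linear_combination h2 / 2

theorem Vdec_lie_mem (X : so m) {q : QuadraticForm ℂ (so m)} (h : q ∈ Vdec m) :
    ⁅X, q⁆ ∈ Vdec m := by
  rw [mem_Vdec] at h ⊢
  intro u v
  have h1 := curv_self ⁅X, q⁆ u v
  rw [curv_lie, curv_symm q (X.1 u) v u v, curv_symm q u (X.1 v) u v,
    (curv_left_alternating h u v u (X.1 v)).2, curv_swap_left, curv_swap_right,
    (curv_left_alternating h v u v (X.1 u)).2] at h1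
  simpa using h1.symm

/-! ### Isotropic part -/

/-- The components of the quadratic form attached to a symmetric bilinear form. -/
def kn (h : LinearMap.BilinForm ℂ (V m)) (u v x y : V m) : ℂ :=
  h u x * form m v y - h u y * form m v x - h v x * form m u y + h v y * form m u x

/-- The symmetric tensor attached to a bilinear form. -/
def symTensor (h : LinearMap.BilinForm ℂ (V m)) : Sym[ℂ]^2 (Dual ℂ (V m)) :=
  ∑ i : Fin (2 * m), ∑ j : Fin (2 * m),
    h (e i) (e j) • SymmetricPower.tprod ℂ ![LinearMap.proj i, LinearMap.proj j]

theorem curv_transport_Psi_tprod (f g : Dual ℂ (V m)) (u v x y : V m) :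
    curv (transport m (Psi m (SymmetricPower.tprod ℂ ![f, g]))) u v x y =
      (f u * g x + g u * f x) * form m v y - (f u * g y + g u * f y) * form m v x
      - (f v * g x + g v * f x) * form m u y + (f v * g y + g v * f y) * form m u x := by
  rw [curv_transport, QuadraticMap.polar, Psi_apply, Psi_apply, Psi_apply]
  simp only [map_add, LinearMap.add_apply, contract_wedge, map_sub, LinearMap.sub_apply, map_smul,
    LinearMap.smul_apply, smul_eq_mul]
  rw [form_comm x u, form_comm x v, form_comm y u, form_comm y v]
  ring

theorem bilin_eq_sum (h : LinearMap.BilinForm ℂ (V m)) (u v : V m) :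
    h u v = ∑ i : Fin (2 * m), ∑ j : Fin (2 * m), h (e i) (e j) * (u i * v j) := by
  conv_lhs => rw [← sum_smul_e u, ← sum_smul_e v]
  simp only [map_sum, LinearMap.sum_apply, map_smul, LinearMap.smul_apply, smul_eq_mul]
  rw [Finset.sum_comm]
  refine Finset.sum_congr rfl fun i _ => ?_
  rw [Finset.mul_sum]
  refine Finset.sum_congr rfl fun j _ => by ring

theorem curv_sum {ι : Type*} (s : Finset ι) (q : ι → QuadraticForm ℂ (so m)) (u v x y : V m) :
    curv (∑ i ∈ s, q i) u v x y = ∑ i ∈ s, curv (q i) u v x y := by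
  classical
  induction s using Finset.induction_on with
  | empty => simp [curv_zero]
  | insert a s ha ih => rw [Finset.sum_insert ha, curv_add, ih, Finset.sum_insert ha]

/-- `kn h` is the Kulkarni–Nomizu product of `h` with the invariant form; the 2 comes from
polarising. -/
theorem curv_transport_Psi_symTensor {h : LinearMap.BilinForm ℂ (V m)} (hs : ∀ u v, h u v = h v u)
    (u v x y : V m) :
    curv (transport m (Psi m (symTensor h))) u v x y = 2 * kn h u v x y := by
  have hs' : ∀ u v, h u v = ∑ i : Fin (2 * m), ∑ j : Fin (2 * m),
      h (e i) (e j) * (u j * v i) := by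
    intro u v
    rw [hs, bilin_eq_sum]
    simp only [mul_comm]
  have h2 : 2 * kn h u v x y = ∑ i : Fin (2 * m), ∑ j : Fin (2 * m), h (e i) (e j) *
      ((u i * x j + u j * x i) * form m v y - (u i * y j + u j * y i) * form m v x
      - (v i * x j + v j * x i) * form m u y + (v i * y j + v j * y i) * form m u x) := by
    have key : ∀ u v, 2 * h u v = ∑ i : Fin (2 * m), ∑ j : Fin (2 * m),
        h (e i) (e j) * (u i * v j + u j * v i) := by
      intro u v
      simp only [mul_add, Finset.sum_add_distrib]
      rw [← bilin_eq_sum, ← hs', two_mul]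
    have e1 : 2 * kn h u v x y = (2 * h u x) * form m v y - (2 * h u y) * form m v x
      - (2 * h v x) * form m u y + (2 * h v y) * form m u x := by rw [kn]; ring
    rw [e1]
    simp only [key, Finset.sum_mul, ← Finset.sum_sub_distrib, ← Finset.sum_add_distrib]
    refine Finset.sum_congr rfl fun i _ => Finset.sum_congr rfl fun j _ => by ring
  rw [h2, symTensor]
  simp only [map_sum, map_smul, curv_sum, curv_smul, curv_transport_Psi_tprod,
    LinearMap.proj_apply]

theorem update_pair_zero {α : Type*} (a b c : α) :
    Function.update ![a, b] 0 c = ![c, b] := by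
  ext i : 1
  fin_cases i <;> rfl

theorem update_pair_one {α : Type*} (a b c : α) :
    Function.update ![a, b] 1 c = ![a, c] := by
  ext i : 1
  fin_cases i <;> rfl

/-- `(f, g) ↦ f · g` as a bilinear map. -/
def symMul (m : ℕ) : Dual ℂ (V m) →ₗ[ℂ] Dual ℂ (V m) →ₗ[ℂ] Sym[ℂ]^2 (Dual ℂ (V m)) :=
  LinearMap.mk₂ ℂ (fun f g => SymmetricPower.tprod ℂ ![f, g])
    (fun f f' g => by
      have := (SymmetricPower.tprod ℂ (ι := Fin 2) (M := Dual ℂ (V m))).map_update_add ![0, g] 0 f f'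
      simpa only [update_pair_zero, update_pair_one] using this)
    (fun c f g => by
      have := (SymmetricPower.tprod ℂ (ι := Fin 2) (M := Dual ℂ (V m))).map_update_smul ![0, g] 0 c f
      simpa only [update_pair_zero, update_pair_one] using this)
    (fun f g g' => by
      have := (SymmetricPower.tprod ℂ (ι := Fin 2) (M := Dual ℂ (V m))).map_update_add ![f, 0] 1 g g'
      simpa only [update_pair_zero, update_pair_one] using this)
    (fun c f g => by
      have := (SymmetricPower.tprod ℂ (ι := Fin 2) (M := Dual ℂ (V m))).map_update_smul ![f, 0] 1 c g
      simpa only [update_pair_zero, update_pair_one] using this)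

theorem symMul_apply (f g : Dual ℂ (V m)) :
    symMul m f g = SymmetricPower.tprod ℂ ![f, g] := rfl

theorem symMul_comm (f g : Dual ℂ (V m)) : symMul m f g = symMul m g f := by
  have := SymmetricPower.tprod_equiv (R := ℂ) (Equiv.swap (0 : Fin 2) 1) ![f, g]
  rw [symMul_apply, symMul_apply, ← this]
  congr 1
  ext i : 1
  fin_cases i <;> simp

theorem dual_eq_sum (f : Dual ℂ (V m)) :
    f = ∑ i : Fin (2 * m), f (e i) • (LinearMap.proj i : Dual ℂ (V m)) := by
  refine LinearMap.ext fun u => ?_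
  conv_lhs => rw [← sum_smul_e u]
  simp [mul_comm]

/-- Symmetric tensors are handled through symmetric bilinear forms, on which traces and contractions
can be computed. -/
theorem symTensor_surjective (t : Sym[ℂ]^2 (Dual ℂ (V m))) :
    ∃ h : LinearMap.BilinForm ℂ (V m), (∀ u v, h u v = h v u) ∧ symTensor h = t := by
  have ht : t ∈ Submodule.span ℂ (Set.range (SymmetricPower.tprod ℂ (ι := Fin 2)
      (M := Dual ℂ (V m)))) := by
    rw [SymmetricPower.span_tprod_eq_top]; trivial
  induction ht using Submodule.span_induction with
  | zero => exact ⟨0, by simp, by simp [symTensor]⟩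
  | add s t _ _ hs ht =>
    obtain ⟨h, hh, rfl⟩ := hs
    obtain ⟨h', hh', rfl⟩ := ht
    refine ⟨h + h', fun u v => by simp [hh u v, hh' u v], ?_⟩
    simp [symTensor, add_smul, Finset.sum_add_distrib]
  | smul c s _ hs =>
    obtain ⟨h, hh, rfl⟩ := hs
    refine ⟨c • h, fun u v => by simp [hh u v], ?_⟩
    simp [symTensor, mul_smul, Finset.smul_sum]
  | mem x hx =>
    obtain ⟨a, rfl⟩ := hx
    have ha : a = ![a 0, a 1] := by ext i : 1; fin_cases i <;> rfl
    rw [ha]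
    generalize a 0 = f
    generalize a 1 = g
    -- The product `f · g` is represented by the symmetrisation of `f ⊗ g`.
    refine ⟨(2⁻¹ : ℂ) • ((LinearMap.mul ℂ ℂ).compl₁₂ f g + (LinearMap.mul ℂ ℂ).compl₁₂ g f),
      fun u v => by simp; ring, ?_⟩
    have key : ∀ f g : Dual ℂ (V m), ∑ i : Fin (2 * m), ∑ j : Fin (2 * m), (f (e i) * g (e j)) •
        symMul m (LinearMap.proj i) (LinearMap.proj j) = symMul m f g := by
      intro f g
      conv_rhs => rw [dual_eq_sum f, dual_eq_sum g]
      simp only [map_sum, LinearMap.sum_apply, map_smul, LinearMap.smul_apply]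
      rw [Finset.sum_comm]
      refine Finset.sum_congr rfl fun i _ => ?_
      rw [Finset.smul_sum]
      refine Finset.sum_congr rfl fun j _ => ?_
      rw [smul_smul, mul_comm (g _)]
    have h1 : symTensor ((2⁻¹ : ℂ) • ((LinearMap.mul ℂ ℂ).compl₁₂ f g +
        (LinearMap.mul ℂ ℂ).compl₁₂ g f)) = ∑ i : Fin (2 * m), ∑ j : Fin (2 * m), (2⁻¹ : ℂ) •
        ((f (e i) * g (e j)) • symMul m (LinearMap.proj i) (LinearMap.proj j) +
        (g (e i) * f (e j)) • symMul m (LinearMap.proj i) (LinearMap.proj j)) := by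
      refine Finset.sum_congr rfl fun i _ => Finset.sum_congr rfl fun j _ => ?_
      rw [← add_smul, smul_smul, symMul_apply]
      simp [mul_add]
    rw [h1, ← symMul_apply]
    simp only [← Finset.smul_sum, Finset.sum_add_distrib, key, symMul_comm g f]
    rw [← two_smul ℂ, smul_smul, inv_mul_cancel₀ two_ne_zero, one_smul]

theorem mem_Viso {q : QuadraticForm ℂ (so m)} :
    q ∈ Viso m ↔ ∃ h : LinearMap.BilinForm ℂ (V m), (∀ u v, h u v = h v u) ∧
      ∀ u v x y, curv q u v x y = kn h u v x y := by
  constructor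
  · rintro ⟨_, ⟨t, rfl⟩, rfl⟩
    obtain ⟨h, hh, rfl⟩ := symTensor_surjective t
    refine ⟨(2 : ℂ) • h, fun u v => by simp [hh u v], fun u v x y => ?_⟩
    rw [curv_transport_Psi_symTensor hh]
    simp [kn]
    ring
  · rintro ⟨h, hh, hq⟩
    refine ⟨_, ⟨symTensor ((2⁻¹ : ℂ) • h), rfl⟩, curv_ext fun u v x y => ?_⟩
    rw [curv_transport_Psi_symTensor (fun u v => by simp [hh u v]), hq]
    simp [kn]
    ring

/-- The trace of a bilinear form. -/
def btrace (h : LinearMap.BilinForm ℂ (V m)) : ℂ := ∑ k : Fin (2 * m), h (e k) (e k.rev)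

theorem btrace_form : btrace (form m) = 2 * m := by
  simp [btrace, form_e_e]

/-- The four terms of `kn` contract to `2m h`, `-h`, `-h` and `(tr h) form`. -/
theorem sum_kn (h : LinearMap.BilinForm ℂ (V m)) (x y : V m) :
    ∑ k : Fin (2 * m), kn h x (e k) y (e k.rev) =
      (2 * m - 2) * h x y + btrace h * form m x y := by
  have h1 := sum_contract_form_left (h x) y
  have h2 := sum_contract_form_right (LinearMap.flip h y) x
  simp only [smul_eq_mul, LinearMap.flip_apply] at h1 h2
  simp only [kn, Finset.sum_sub_distrib, Finset.sum_add_distrib, ← Finset.sum_mul,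
    ← Finset.mul_sum]
  have h3 : ∑ k : Fin (2 * m), form m (e k) (e k.rev) = 2 * m := btrace_form
  have h4 : ∑ k : Fin (2 * m), h x (e k.rev) * form m (e k) y = h x y := by
    rw [← h1]
    exact Finset.sum_congr rfl fun k _ => by rw [form_comm, mul_comm]
  have h5 : ∑ k : Fin (2 * m), h (e k) y * form m x (e k.rev) = h x y := by
    rw [← h2]
    exact Finset.sum_congr rfl fun k _ => by rw [mul_comm]
  rw [h3, h4, h5, btrace]
  ring

theorem ric_of_kn {q : QuadraticForm ℂ (so m)} {h : LinearMap.BilinForm ℂ (V m)}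
    (hq : ∀ u v x y, curv q u v x y = kn h u v x y) (x y : V m) :
    ric q x y = (2 * m - 2) * h x y + btrace h * form m x y := by
  simp only [ric, hq, sum_kn]

/-- Taking the trace gives `(4m - 2) tr h = 0`; then `(2m - 2) h = 0`. -/
theorem eq_zero_of_ric_kn (hm : 4 ≤ m) {h : LinearMap.BilinForm ℂ (V m)}
    (hr : ∀ x y, (2 * m - 2) * h x y + btrace h * form m x y = 0) : h = 0 := by
  have hm' : (m : ℂ) - 1 ≠ 0 := by
    rw [sub_ne_zero]; norm_cast; omega
  have hm2 : 2 * (m : ℂ) - 1 ≠ 0 := by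
    rw [sub_ne_zero]; norm_cast; omega
  have ht : btrace h = 0 := by
    have : ∑ k : Fin (2 * m), ((2 * m - 2) * h (e k) (e k.rev) +
        btrace h * form m (e k) (e k.rev)) = 0 := Finset.sum_eq_zero fun k _ => hr _ _
    rw [Finset.sum_add_distrib, ← Finset.mul_sum, ← Finset.mul_sum] at this
    have h3 : ∑ k : Fin (2 * m), form m (e k) (e k.rev) = 2 * m := btrace_form
    rw [h3, ← btrace] at this
    have h4 : (2 * (m : ℂ) - 1) * (2 * btrace h) = 0 := by linear_combination this
    simpa [hm2] using h4
  refine LinearMap.ext fun x => LinearMap.ext fun y => ?_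
  have := hr x y
  rw [ht] at this
  have h4 : ((m : ℂ) - 1) * (2 * h x y) = 0 := by linear_combination this
  simpa [hm'] using h4

theorem Psi_injective (hm : 4 ≤ m) : Function.Injective (Psi m) := by
  rw [injective_iff_map_eq_zero]
  intro t ht
  obtain ⟨h, hh, rfl⟩ := symTensor_surjective t
  have h0 : h = 0 := by
    refine eq_zero_of_ric_kn hm fun x y => ?_
    rw [← sum_kn]
    refine Finset.sum_eq_zero fun k _ => ?_
    have := curv_transport_Psi_symTensor hh x (e k) y (e k.rev)
    rw [ht, map_zero, curv_zero] at this
    simpa using this.symm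
  simp [h0, symTensor]

theorem bianchi_of_kn {q : QuadraticForm ℂ (so m)} {h : LinearMap.BilinForm ℂ (V m)}
    (hs : ∀ u v, h u v = h v u) (hq : ∀ u v x y, curv q u v x y = kn h u v x y) (u v x y : V m) :
    bianchi q u v x y = 0 := by
  simp only [bianchi, hq, kn, hs x, hs v u, form_comm x, form_comm v u]
  ring

theorem Viso_lie_mem (X : so m) {q : QuadraticForm ℂ (so m)} (hq : q ∈ Viso m) :
    ⁅X, q⁆ ∈ Viso m := by
  rw [mem_Viso] at hq ⊢
  obtain ⟨h, hh, hq⟩ := hq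
  -- The witness is `X` acting on `h`; the terms where `X` hits the invariant form cancel by
  -- skewness.
  refine ⟨- (h.compl₁₂ X.1 LinearMap.id + h.compl₁₂ LinearMap.id X.1), fun u v => ?_,
    fun u v x y => ?_⟩
  · simp [hh u, add_comm]
    exact hh _ _
  · simp only [curv_lie, hq, kn, LinearMap.neg_apply, LinearMap.add_apply, LinearMap.compl₁₂_apply,
      LinearMap.id_apply, so_skew]
    ring

/-! ### The decomposition -/

/-- The Ricci contraction as a bilinear form. -/
def ricForm (q : QuadraticForm ℂ (so m)) : LinearMap.BilinForm ℂ (V m) :=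
  LinearMap.mk₂ ℂ (ric q)
    (by intros; simp [ric, curv, Finset.sum_add_distrib])
    (by intros; simp [ric, curv, Finset.mul_sum])
    (by intros; simp [ric, curv, Finset.sum_add_distrib])
    (by intros; simp [ric, curv, Finset.mul_sum])

theorem ric_comm (q : QuadraticForm ℂ (so m)) (x y : V m) : ric q x y = ric q y x := by
  rw [ric, ← Equiv.sum_comp Fin.revPerm]
  simp only [Fin.revPerm_apply, Fin.rev_rev, ric]
  exact Finset.sum_congr rfl fun k _ => curv_symm _ _ _ _ _

theorem exists_Viso_ric_eq (hm : 4 ≤ m) (q : QuadraticForm ℂ (so m)) :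
    ∃ r ∈ Viso m, ∀ x y, ric r x y = ric q x y := by
  have hm' : (m : ℂ) - 1 ≠ 0 := by
    rw [sub_ne_zero]; norm_cast; omega
  have hm2 : 2 * (m : ℂ) - 1 ≠ 0 := by
    rw [sub_ne_zero]; norm_cast; omega
  set t := btrace (ricForm q) with ht
  -- Solve `(2m-2) h + (tr h) form = ric q`: taking traces forces `tr h = t / (2(2m-1))`.
  set h : LinearMap.BilinForm ℂ (V m) := (2 * (m : ℂ) - 2)⁻¹ •
    (ricForm q - (t / (2 * (2 * m - 1))) • form m) with hh
  have hs : ∀ u v, h u v = h v u := fun u v => by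
    have : ricForm q u v = ricForm q v u := ric_comm q u v
    simp [hh, this, form_comm u v]
  have hb : btrace h = (2 * (m : ℂ) - 2)⁻¹ * (t - t / (2 * (2 * m - 1)) * (2 * m)) := by
    have hf : ∑ k : Fin (2 * m), form m (e k) (e k.rev) = 2 * m := btrace_form
    have ht' : ∑ k : Fin (2 * m), ricForm q (e k) (e k.rev) = t := rfl
    rw [btrace]
    simp only [hh, LinearMap.smul_apply, LinearMap.sub_apply, smul_eq_mul, ← Finset.mul_sum,
      Finset.sum_sub_distrib]
    rw [hf, ht']
  refine ⟨transport m (Psi m (symTensor ((2⁻¹ : ℂ) • h))), ⟨_, ⟨_, rfl⟩, rfl⟩, fun x y => ?_⟩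
  have hq : ∀ u v x y, curv (transport m (Psi m (symTensor ((2⁻¹ : ℂ) • h)))) u v x y =
      kn h u v x y := by
    intro u v x y
    rw [curv_transport_Psi_symTensor (fun u v => by simp [hs u v])]
    simp [kn]
    ring
  rw [ric_of_kn hq, hb]
  have hx : h x y = (2 * (m : ℂ) - 2)⁻¹ * (ric q x y - t / (2 * (2 * m - 1)) * form m x y) := rfl
  rw [hx]
  have hm3 : 2 * (m : ℂ) - 2 ≠ 0 := fun h0 => hm' (by linear_combination h0 / 2)
  field_simp
  ring

theorem exists_decomposition (hm : 4 ≤ m) (q : QuadraticForm ℂ (so m)) :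
    ∃ c ∈ weyl m, ∃ d ∈ Vdec m, ∃ i ∈ Viso m, c + d + i = q := by
  obtain ⟨i, hi, hr⟩ := exists_Viso_ric_eq hm q
  refine ⟨q - decPart q - i, ⟨fun u v x y => ?_, fun x y => ?_⟩, decPart q, decPart_mem q, i, hi,
    by abel⟩
  · obtain ⟨h, hs, hq⟩ := mem_Viso.1 hi
    have h1 := bianchi_of_kn hs hq u v x y
    have h2 := bianchi_decPart q u v x y
    simp only [bianchi, curv_sub] at h1 h2 ⊢
    linear_combination - h1 - h2
  · have h1 := hr x y
    have h2 := ric_eq_zero_of_mem_Vdec (decPart_mem q) x y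
    simp only [ric, curv_sub, Finset.sum_sub_distrib] at h1 h2 ⊢
    linear_combination - h1 - h2

/-- The Bianchi sum sees only the `Vdec` component and recovers it up to a factor 3; the Ricci
contraction then sees only the `Viso` component and determines its `h`. -/
theorem decomposition_unique (hm : 4 ≤ m) {c d i : QuadraticForm ℂ (so m)} (hc : c ∈ weyl m)
    (hd : d ∈ Vdec m) (hi : i ∈ Viso m) (h : c + d + i = 0) : c = 0 ∧ d = 0 ∧ i = 0 := by
  obtain ⟨k, hs, hq⟩ := mem_Viso.1 hi
  have hd0 : d = 0 := by
    refine eq_zero_of_curv fun u v x y => ?_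
    have h1 := bianchi_zero u v x y
    rw [← h, bianchi_add, bianchi_add, hc.1, bianchi_of_kn hs hq, 
      bianchi_of_vanishing (mem_Vdec.1 hd)] at h1
    simpa using h1
  have hi0 : i = 0 := by
    have hk : k = 0 := by
      refine eq_zero_of_ric_kn hm fun x y => ?_
      rw [← ric_of_kn hq]
      have h1 := ric_zero x y
      rwa [← h, ric_add, ric_add, hc.2, ric_eq_zero_of_mem_Vdec hd, zero_add, zero_add] at h1
    refine eq_zero_of_curv fun u v x y => ?_
    rw [hq, hk]
    simp [kn]
  refine ⟨?_, hd0, hi0⟩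
  rwa [hd0, hi0, add_zero, add_zero] at h

/-! ### Isotropic vectors -/

theorem form_nondegenerate : (form m).Nondegenerate := by
  refine ⟨fun x hx => form_nondeg fun u => ?_, fun x hx => form_nondeg fun u => ?_⟩
  · rw [form_comm, hx, map_zero]
  · rw [hx, map_zero]

theorem form_isRefl : (form m).IsRefl := fun x y h => by rw [form_comm]; exact h

theorem exists_form_eq (f : Dual ℂ (V m)) : ∃ x, ∀ v, form m x v = f v := by
  refine ⟨fun i => f (e i.rev), fun v => ?_⟩
  conv_rhs => rw [← sum_smul_e v, map_sum]
  rw [form_apply, ← Equiv.sum_comp Fin.revPerm]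
  simp [mul_comm]

theorem exists_form_self_eq_one {S : Submodule ℂ (V m)} {w : V m} (hw : w ∈ S)
    (h : form m w w ≠ 0) : ∃ x ∈ S, form m x x = 1 := by
  obtain ⟨s, hs⟩ := IsAlgClosed.exists_pow_nat_eq (form m w w)⁻¹ (n := 2) (by norm_num)
  refine ⟨s • w, S.smul_mem _ hw, ?_⟩
  rw [map_smul, LinearMap.map_smul₂, smul_eq_mul, smul_eq_mul, ← mul_assoc, ← pow_two, hs,
    inv_mul_cancel₀ h]

theorem mem_orthogonal_form {S : Submodule ℂ (V m)} {w : V m} :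
    w ∈ (form m).orthogonal S ↔ ∀ s ∈ S, form m s w = 0 := Iff.rfl

/-- If `S^⊥` is totally isotropic, polarising gives `S^⊥ ≤ S^⊥⊥ = S`. -/
theorem orthogonal_le_of_isotropic {S : Submodule ℂ (V m)}
    (h : ∀ w ∈ (form m).orthogonal S, form m w w = 0) : (form m).orthogonal S ≤ S := by
  have h2 : (form m).orthogonal S ≤ (form m).orthogonal ((form m).orthogonal S) := by
    intro x hx y hy
    have a := h _ (Submodule.add_mem _ hx hy)
    simp only [map_add, LinearMap.add_apply, h x hx, h y hy, form_comm x y] at a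
    change form m y x = 0
    linear_combination a / 2
  rwa [LinearMap.BilinForm.orthogonal_orthogonal form_nondegenerate form_isRefl] at h2

theorem finrank_orthogonal_form (S : Submodule ℂ (V m)) :
    finrank ℂ ((form m).orthogonal S) = 2 * m - finrank ℂ S := by
  rw [LinearMap.BilinForm.finrank_orthogonal form_nondegenerate]
  simp

/-- The orthogonal complement of a space of dimension at most three contains an orthonormal
pair. -/
theorem exists_orthonormal_pair (hm : 4 ≤ m) {S : Submodule ℂ (V m)} (hS : finrank ℂ S ≤ 3) :
    ∃ w ∈ (form m).orthogonal S, ∃ y ∈ (form m).orthogonal S,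
      form m w w = 1 ∧ form m y y = 1 ∧ form m w y = 0 := by
  -- Otherwise `S^⊥ ≤ S`, impossible since `dim S^⊥ ≥ 2m - 3 ≥ 5`.
  have h1 : ∃ w ∈ (form m).orthogonal S, form m w w ≠ 0 := by
    by_contra! h
    have := Submodule.finrank_mono (orthogonal_le_of_isotropic h)
    rw [finrank_orthogonal_form] at this
    omega
  obtain ⟨w, hw, hw1⟩ := h1
  obtain ⟨w, hw, hw1⟩ := exists_form_self_eq_one hw hw1
  have hT : finrank ℂ (S ⊔ ℂ ∙ w : Submodule ℂ (V m)) ≤ 4 := by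
    have a := Submodule.finrank_add_le_finrank_add_finrank S (ℂ ∙ w)
    have b := finrank_span_singleton (K := ℂ) (v := w) fun h0 => by simp [h0] at hw1
    omega
  have h2 : ∃ y ∈ (form m).orthogonal (S ⊔ ℂ ∙ w), form m y y ≠ 0 := by
    by_contra! h
    have hle := orthogonal_le_of_isotropic h
    -- For `m = 4` the dimensions can be equal (`4 = 4`), so the contradiction comes from `w`, which
    -- would be isotropic.
    have heq := Submodule.eq_of_le_of_finrank_le hle (by rw [finrank_orthogonal_form]; omega)
    have hw2 : w ∈ (form m).orthogonal (S ⊔ ℂ ∙ w) := by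
      rw [heq]
      exact Submodule.mem_sup_right (Submodule.mem_span_singleton_self w)
    rw [h w hw2] at hw1
    exact zero_ne_one hw1
  obtain ⟨y, hy, hy1⟩ := h2
  obtain ⟨y, hy, hy1⟩ := exists_form_self_eq_one hy hy1
  exact ⟨w, hw, y, fun s hs => hy s (Submodule.mem_sup_left hs), hw1, hy1,
    hy w (Submodule.mem_sup_right (Submodule.mem_span_singleton_self w))⟩

/-- For an orthonormal pair `w`, `y` in `S^⊥` the vector `w + i y` is isotropic; it pairs to 1 with
`w ∈ S^⊥`, so it is not in `S`. -/
theorem exists_isotropic_perp (hm : 4 ≤ m) {S : Submodule ℂ (V m)} (hS : finrank ℂ S ≤ 3) :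
    ∃ z ∈ (form m).orthogonal S, form m z z = 0 ∧ z ∉ S := by
  obtain ⟨w, hw, y, hy, hww, hyy, hwy⟩ := exists_orthonormal_pair hm hS
  refine ⟨w + Complex.I • y, Submodule.add_mem _ hw (Submodule.smul_mem _ _ hy), ?_, fun h => ?_⟩
  · simp only [map_add, LinearMap.add_apply, map_smul, LinearMap.smul_apply, hww, hyy, hwy,
      form_comm y w, smul_eq_mul]
    linear_combination Complex.I_mul_I
  · have a : form m (w + Complex.I • y) w = 0 := hw _ h
    simp [hww, form_comm y w, hwy] at a

theorem finrank_span_triple_le (u v w : V m) : finrank ℂ (Submodule.span ℂ {u, v, w}) ≤ 3 := by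
  classical
  rw [← show (({u, v, w} : Finset (V m)) : Set (V m)) = {u, v, w} by simp]
  exact (finrank_span_finset_le_card _).trans Finset.card_le_three

theorem exists_isotropic_perp_triple (hm : 4 ≤ m) (u v w : V m) :
    ∃ z, form m u z = 0 ∧ form m v z = 0 ∧ form m w z = 0 ∧ form m z z = 0 ∧
      z ∉ Submodule.span ℂ {u, v, w} := by
  obtain ⟨z, hz, h0, h1⟩ := exists_isotropic_perp hm (finrank_span_triple_le u v w)
  exact ⟨z, hz u (Submodule.subset_span (by simp)), hz v (Submodule.subset_span (by simp)),
    hz w (Submodule.subset_span (by simp)), h0, h1⟩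

/-! ### Transvections -/

/-- All members of `J` vanish at `u ∧ v`. -/
def VanishAt (J : Set (QuadraticForm ℂ (so m))) (u v : V m) : Prop := ∀ q ∈ J, q (bv m u v) = 0

theorem VanishAt.swap {J : Set (QuadraticForm ℂ (so m))} {u v : V m} (h : VanishAt J u v) :
    VanishAt J v u := fun q hq => by rw [bv_swap, QuadraticMap.map_neg, h q hq]

theorem VanishAt.of_mem_span {J : Set (QuadraticForm ℂ (so m))} {u v w : V m}
    (h : VanishAt J u v) (hw : w ∈ Submodule.span ℂ {u, v}) : VanishAt J u w := by
  obtain ⟨a, b, rfl⟩ := Submodule.mem_span_pair.1 hw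
  intro q hq
  rw [map_add, map_smul, map_smul, bv_self, smul_zero, zero_add, QuadraticMap.map_smul, h q hq,
    smul_zero]

/-! ### Lie derivatives of polar forms and the action of `exp X` -/

theorem polar_lie (X : so m) (q : QuadraticForm ℂ (so m)) (Y Z : so m) :
    ⁅X, q⁆.polarBilin Y Z = - (q.polarBilin Y ⁅X, Z⁆ + q.polarBilin Z ⁅X, Y⁆) :=
  polar_quadLie X q Y Z

theorem quad_add (q : QuadraticForm ℂ (so m)) (Y Z : so m) :
    q (Y + Z) = q Y + q Z + q.polarBilin Y Z := QuadraticMap.map_add q Y Z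

theorem polarBilin_self (q : QuadraticForm ℂ (so m)) (Y : so m) :
    q.polarBilin Y Y = 2 * q Y := by simp [QuadraticMap.polar_self]

theorem polarBilin_comm (q : QuadraticForm ℂ (so m)) (Y Z : so m) :
    q.polarBilin Y Z = q.polarBilin Z Y := QuadraticMap.polar_comm _ _ _

theorem lie_quad_eq (X : so m) (q : QuadraticForm ℂ (so m)) (Y : so m) :
    ⁅X, q⁆ Y = - q.polarBilin Y ⁅X, Y⁆ := rfl

theorem polar_lie_lie (X : so m) (q : QuadraticForm ℂ (so m)) (Y Z : so m) :
    ⁅X, ⁅X, q⁆⁆.polarBilin Y Z = q.polarBilin Y ⁅X, ⁅X, Z⁆⁆ + 2 * q.polarBilin ⁅X, Y⁆ ⁅X, Z⁆ +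
      q.polarBilin ⁅X, ⁅X, Y⁆⁆ Z := by
  rw [polar_lie, polar_lie, polar_lie, polarBilin_comm q ⁅X, Z⁆ ⁅X, Y⁆,
    polarBilin_comm q Z ⁅X, ⁅X, Y⁆⁆]
  ring

/-- Here `α + β + γ = exp(X) α`, and `q (exp(X) α)` is the sum of the `(-1)^k / k!` times the `k`-th
Lie derivative of `q` at `α`, which stops at `k = 4`. -/
theorem quad_add_add_eq_zero {X α β γ : so m} {q : QuadraticForm ℂ (so m)} (hα : ⁅X, α⁆ = β)
    (hβ : ⁅X, β⁆ = (2 : ℂ) • γ) (hγ : ⁅X, γ⁆ = 0) (k0 : q α = 0) (k1 : ⁅X, q⁆ α = 0)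
    (k2 : ⁅X, ⁅X, q⁆⁆ α = 0) (k3 : ⁅X, ⁅X, ⁅X, q⁆⁆⁆ α = 0)
    (k4 : ⁅X, ⁅X, ⁅X, ⁅X, q⁆⁆⁆⁆ α = 0) : q (α + β + γ) = 0 := by
  have c1 : q.polarBilin α β = 0 := by
    rw [lie_quad_eq, hα] at k1
    linear_combination - k1
  have c2 : q β + q.polarBilin α γ = 0 := by
    rw [lie_quad_eq, polar_lie, hα, hβ, polarBilin_self, map_smul, smul_eq_mul] at k2
    linear_combination k2 / 2
  have c3 : q.polarBilin β γ = 0 := by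
    rw [lie_quad_eq, polar_lie_lie, hα, hβ, lie_smul, hγ, smul_zero, map_zero, map_smul, map_smul,
      LinearMap.smul_apply, smul_eq_mul, smul_eq_mul, polarBilin_comm q γ β] at k3
    linear_combination - k3 / 6
  have c4 : q γ = 0 := by
    rw [lie_quad_eq, polar_lie, polar_lie_lie, polar_lie_lie, hα, hβ, lie_smul, lie_smul] at k4
    simp only [hγ, smul_zero, lie_zero, map_zero, map_smul, LinearMap.smul_apply, smul_eq_mul,
      polarBilin_self, LinearMap.zero_apply] at k4
    linear_combination k4 / 24
  rw [quad_add, quad_add, map_add, LinearMap.add_apply, k0, c1, c3, c4]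
  linear_combination c2

/-- If `X² = 0`, then `1 + X = exp X`. Stability of `J` under the Lie algebra supplies the
derivatives needed at `u ∧ v`, so no group action is required. -/
theorem VanishAt.transvection {J : LieSubmodule ℂ (so m) (QuadraticForm ℂ (so m))} {u v : V m}
    (h : VanishAt (J : Set (QuadraticForm ℂ (so m))) u v) {X : so m}
    (hX : ∀ z, X.1 (X.1 z) = 0) :
    VanishAt (J : Set (QuadraticForm ℂ (so m))) (u + X.1 u) (v + X.1 v) := by
  intro q hq
  have hq1 := J.lie_mem (x := X) hq
  have hq2 := J.lie_mem (x := X) hq1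
  have hq3 := J.lie_mem (x := X) hq2
  have hq4 := J.lie_mem (x := X) hq3
  have hα : ⁅X, bv m u v⁆ = bv m (X.1 u) v + bv m u (X.1 v) := lie_bv X u v
  have hβ : ⁅X, bv m (X.1 u) v + bv m u (X.1 v)⁆ = (2 : ℂ) • bv m (X.1 u) (X.1 v) := by
    rw [lie_add, lie_bv, lie_bv, hX, hX, map_zero, map_zero, LinearMap.zero_apply, two_smul]
    abel
  have hγ : ⁅X, bv m (X.1 u) (X.1 v)⁆ = 0 := by
    rw [lie_bv, hX, hX, map_zero, map_zero, LinearMap.zero_apply, add_zero]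
  have hsum : bv m (u + X.1 u) (v + X.1 v) =
      bv m u v + (bv m (X.1 u) v + bv m u (X.1 v)) + bv m (X.1 u) (X.1 v) := by
    simp only [map_add, LinearMap.add_apply]
    abel
  rw [hsum]
  exact quad_add_add_eq_zero hα hβ hγ (h q hq) (h _ hq1) (h _ hq2) (h _ hq3) (h _ hq4)

theorem bv_sq_zero {x y : V m} (hx : form m x x = 0) (hy : form m y y = 0) (hxy : form m x y = 0)
    (z : V m) : (bv m x y).1 ((bv m x y).1 z) = 0 := by
  simp [bv_apply, hx, hy, hxy, form_comm y x]

/-- With `z` isotropic, orthogonal to `u` and pairing to 1 with `v` and `w`, the element `z ∧ (w -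
v)` squares to zero, kills `u` and sends `v` to `w - v`; its transvection carries `u ∧ v` to `u ∧
w`. -/
theorem VanishAt.move_of_orthogonal {J : LieSubmodule ℂ (so m) (QuadraticForm ℂ (so m))}
    {u v w : V m} (h : VanishAt (J : Set (QuadraticForm ℂ (so m))) u v)
    (huv : form m u v = 0) (huw : form m u w = 0) (hvv : form m v v = 0) (hww : form m w w = 0)
    (hvw : form m v w = 0) (hv : v ∉ Submodule.span ℂ {u}) :
    VanishAt (J : Set (QuadraticForm ℂ (so m))) u w := by
  by_cases hw : w ∈ Submodule.span ℂ {u, v}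
  · exact h.of_mem_span hw
  -- This is what allows a functional killing `u` and `w - v` but not `v`.
  have hv2 : v ∉ Submodule.span ℂ {u, w - v} := by
    intro hmem
    obtain ⟨a, b, hab⟩ := Submodule.mem_span_pair.1 hmem
    by_cases hb : b = 0
    · apply hv
      rw [← hab, hb, zero_smul, add_zero]
      exact Submodule.smul_mem _ _ (Submodule.mem_span_singleton_self u)
    · apply hw
      refine Submodule.mem_span_pair.2 ⟨- (b⁻¹ * a), b⁻¹ * (1 + b), ?_⟩
      have h1 : b • w = (1 + b) • v - a • u := by
        rw [add_smul, one_smul]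
        nth_rewrite 1 [← hab]
        rw [smul_sub]
        abel
      rw [← inv_smul_smul₀ hb w, h1]
      module
  obtain ⟨f, hf, hfm⟩ := Submodule.exists_dual_map_eq_bot_of_notMem hv2 inferInstance
  have hf0 : ∀ z ∈ Submodule.span ℂ {u, w - v}, f z = 0 := fun z hz => by
    have : f z ∈ Submodule.map f (Submodule.span ℂ {u, w - v}) := Submodule.mem_map_of_mem hz
    rwa [hfm, Submodule.mem_bot] at this
  obtain ⟨x, hx⟩ := exists_form_eq ((f v)⁻¹ • f)
  have hxu : form m x u = 0 := by
    rw [hx, LinearMap.smul_apply, hf0 u (Submodule.subset_span (by simp)), smul_zero]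
  have hxv : form m x v = 1 := by
    rw [hx, LinearMap.smul_apply, smul_eq_mul, inv_mul_cancel₀ hf]
  have hxw : form m x w = 1 := by
    have : form m x (w - v) = 0 := by
      rw [hx, LinearMap.smul_apply, hf0 (w - v) (Submodule.subset_span (by simp)), smul_zero]
    rw [map_sub, hxv] at this
    linear_combination this
  -- The correction makes `z` isotropic and, as `v` is orthogonal to `u`, `v` and `w`, keeps the
  -- three pairings.
  set z := x - (form m x x / 2) • v with hz
  have hzz : form m z z = 0 := by
    simp only [hz, map_sub, LinearMap.sub_apply, map_smul, LinearMap.smul_apply, form_comm v x,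
      hxv, hvv, smul_eq_mul]
    ring
  have hzu : form m z u = 0 := by simp [hz, hxu, form_comm v u, huv]
  have hzv : form m z v = 1 := by simp [hz, hxv, hvv]
  have hzw : form m z w = 1 := by simp [hz, hxw, hvw]
  have key := h.transvection (X := bv m z (w - v)) (bv_sq_zero hzz
    (by simp [hvv, hww, hvw, form_comm w v]) (by simp [hzv, hzw]))
  have hXu : (bv m z (w - v)).1 u = 0 := by
    rw [bv_apply]
    simp [hzu, form_comm w u, form_comm v u, huv, huw]
  have hXv : (bv m z (w - v)).1 v = w - v := by
    rw [bv_apply]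
    simp [hzv, form_comm w v, hvw, hvv]
  rwa [hXu, hXv, add_zero, add_sub_cancel] at key

/-- An isotropic `z` orthogonal to `u`, `v`, `w` and outside their span serves as a stepping stone,
removing the assumption that `v` and `w` are orthogonal. -/
theorem VanishAt.move (hm : 4 ≤ m) {J : LieSubmodule ℂ (so m) (QuadraticForm ℂ (so m))}
    {u v w : V m} (h : VanishAt (J : Set (QuadraticForm ℂ (so m))) u v) 
    (huv : form m u v = 0) (huw : form m u w = 0) (hvv : form m v v = 0) (hww : form m w w = 0)
    (hv : v ∉ Submodule.span ℂ {u}) :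
    VanishAt (J : Set (QuadraticForm ℂ (so m))) u w := by
  obtain ⟨z, hz1, hz2, hz3, hz0, hz⟩ := exists_isotropic_perp_triple hm u v w
  refine (h.move_of_orthogonal huv hz1 hvv hz0 hz2 hv).move_of_orthogonal hz1 huw hz0 hww
    (by rw [form_comm, hz3]) fun hzu => hz (Submodule.span_mono (by simp) hzu)

/-- A vanishing condition at one isotropic plane propagates to all isotropic planes. -/
theorem vanishAt_of_isotropic (hm : 4 ≤ m) {J : LieSubmodule ℂ (so m) (QuadraticForm ℂ (so m))}
    {a b : V m} (h : VanishAt (J : Set (QuadraticForm ℂ (so m))) a b) (ha0 : a ≠ 0) (haa : form m a a = 0)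
    (hbb : form m b b = 0) (hab : form m a b = 0) (hb : b ∉ Submodule.span ℂ {a})
    {u v : V m} (huu : form m u u = 0) (hvv : form m v v = 0) (huv : form m u v = 0) :
    VanishAt (J : Set (QuadraticForm ℂ (so m))) u v := by
  obtain ⟨z, hz1, hz2, hz3, hz0, hz⟩ := exists_isotropic_perp_triple hm a u v
  have hza : z ∉ Submodule.span ℂ {a} := fun h => hz (Submodule.span_mono (by simp) h)
  have hzv : z ∉ Submodule.span ℂ {v} := fun h => hz (Submodule.span_mono (by simp) h)
  by_cases ha : a ∈ Submodule.span ℂ {z}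
  · exfalso
    obtain ⟨c, rfl⟩ := Submodule.mem_span_singleton.1 ha
    rw [Submodule.mem_span_singleton] at hza
    by_cases hc : c = 0
    · exact ha0 (by rw [hc, zero_smul])
    · exact hza ⟨c⁻¹, by rw [smul_smul, inv_mul_cancel₀ hc, one_smul]⟩
  -- Move one vector at a time: `a ∧ b` to `a ∧ z`, to `z ∧ v`, to `u ∧ v`.
  have h1 : VanishAt (J : Set (QuadraticForm ℂ (so m))) a z :=
    h.move hm hab hz1 hbb hz0 hb
  have h2 : VanishAt (J : Set (QuadraticForm ℂ (so m))) z v :=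
    h1.swap.move hm (by rw [form_comm, hz1]) (by rw [form_comm, hz3]) haa hvv ha
  exact (h2.swap.move hm hz3 (by rw [form_comm, huv]) hz0 huu hzv).swap

/-! ### Vanishing of Weyl-type forms -/

/-- Subtract `B(w,w) form` to get `D`. For `x ⊥ w` and `s² = -(x,x)`, both `x ± s w` are isotropic:
the sum of the two equations gives `D(x,x) = 0`, the difference gives `s D(x,w) = 0`. -/
theorem bilin_eq_smul_of_isotropic {B : LinearMap.BilinForm ℂ (V m)} (hB : ∀ x y, B x y = B y x)
    {W : Submodule ℂ (V m)} {w y : V m} (hw : w ∈ W) (hy : y ∈ W) (hww : form m w w = 1)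
    (hyy : form m y y = 1) (hwy : form m w y = 0)
    (h : ∀ x ∈ W, form m x x = 0 → B x x = 0) :
    ∃ c : ℂ, ∀ x ∈ W, ∀ z ∈ W, B x z = c * form m x z := by
  set D : LinearMap.BilinForm ℂ (V m) := B - (B w w) • form m with hD
  have hDapp : ∀ x z, D x z = B x z - B w w * form m x z := fun x z => rfl
  have hDs : ∀ x z, D x z = D z x := fun x z => by rw [hDapp, hDapp, hB, form_comm]
  have hD0 : ∀ x ∈ W, form m x x = 0 → D x x = 0 := fun x hx h0 => by
    rw [hDapp, h x hx h0, h0, mul_zero, sub_zero]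
  have hDw : D w w = 0 := by rw [hDapp, hww]; ring
  have h1 : ∀ x ∈ W, form m x w = 0 → D x x = 0 ∧ (form m x x ≠ 0 → D x w = 0) := by
    intro x hx hxw
    obtain ⟨s, hs⟩ := IsAlgClosed.exists_pow_nat_eq (- form m x x) (n := 2) (by norm_num)
    have a := hD0 (x + s • w) (W.add_mem hx (W.smul_mem _ hw)) (by
      simp only [map_add, LinearMap.add_apply, map_smul, LinearMap.smul_apply, hww, hxw,
        form_comm w x, smul_eq_mul]
      linear_combination hs)
    have b := hD0 (x - s • w) (W.sub_mem hx (W.smul_mem _ hw)) (by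
      simp only [map_sub, LinearMap.sub_apply, map_smul, LinearMap.smul_apply, hww, hxw,
        form_comm w x, smul_eq_mul]
      linear_combination hs)
    simp only [map_add, map_sub, LinearMap.add_apply, LinearMap.sub_apply, map_smul,
      LinearMap.smul_apply, hDs w x, hDw, smul_eq_mul] at a b
    refine ⟨by linear_combination (a + b) / 2, fun hne => ?_⟩
    have hs0 : s ≠ 0 := fun h0 => hne (by rw [h0] at hs; linear_combination hs)
    have c : s * D x w = 0 := by linear_combination (a - b) / 4
    exact (mul_eq_zero.1 c).resolve_left hs0
  have hyw : D y w = 0 := (h1 y hy (by rw [form_comm, hwy])).2 (by rw [hyy]; exact one_ne_zero)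
  have h2 : ∀ x ∈ W, form m x w = 0 → D x w = 0 := by
    intro x hx hxw
    by_cases h0 : form m x x = 0
    · have ha := (h1 (x + y) (W.add_mem hx hy) (by simp [hxw, form_comm y w, hwy])).2
      have hb := (h1 (x - y) (W.sub_mem hx hy) (by simp [hxw, form_comm y w, hwy])).2
      simp only [map_add, map_sub, LinearMap.add_apply, LinearMap.sub_apply, h0, hyy,
        form_comm y x, hyw, add_zero, sub_zero] at ha hb
      by_cases hc : 0 + form m x y + (form m x y + 1) = 0
      · exact hb fun hd => by
          have : (2 : ℂ) = 0 := by linear_combination hc + hd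
          exact two_ne_zero this
      · exact ha hc
    · exact (h1 x hx hxw).2 h0
  have h3 : ∀ x ∈ W, D x x = 0 := by
    intro x hx
    have hx0 : x - form m x w • w ∈ W := W.sub_mem hx (W.smul_mem _ hw)
    have hxw : form m (x - form m x w • w) w = 0 := by simp [hww]
    have a := (h1 _ hx0 hxw).1
    have b := h2 _ hx0 hxw
    simp only [map_sub, LinearMap.sub_apply, map_smul, LinearMap.smul_apply, hDs w x, hDw,
      smul_eq_mul] at a b
    linear_combination a + 2 * form m x w * b
  refine ⟨B w w, fun x hx z hz => ?_⟩
  have a := h3 (x + z) (W.add_mem hx hz)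
  simp only [map_add, LinearMap.add_apply, h3 x hx, h3 z hz, hDs z x] at a
  rw [hDapp] at a
  linear_combination a / 2

/-- Splitting every vector along `p` and `u^⊥` expresses `D` through `D(p,·)`, `D(·,p)` and
`D(p,p)`, and each term contracts at once. -/
theorem btrace_of_vanishing {D : LinearMap.BilinForm ℂ (V m)}
    {u p : V m} (hp : form m p u = 1)
    (h : ∀ x y, form m x u = 0 → form m y u = 0 → D x y = 0) :
    btrace D = D p u + D u p - form m u u * D p p := by
  have key : ∀ x y, D x y = form m u x * D p y + form m u y * D x p
      - form m u x * (form m u y * D p p) := by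
    intro x y
    have a := h (x - form m x u • p) (y - form m y u • p) (by simp [hp]) (by simp [hp])
    simp only [map_sub, LinearMap.sub_apply, map_smul, LinearMap.smul_apply, smul_eq_mul] at a
    rw [form_comm u x, form_comm u y]
    linear_combination a
  have h1 := sum_contract_form_left (D p) u
  have h2 := sum_contract_form_right (LinearMap.flip D p) u
  have h3 := sum_contract_form_left (form m u) u
  simp only [smul_eq_mul] at h1 h2 h3
  rw [btrace, Finset.sum_congr rfl fun k _ => key _ _, Finset.sum_sub_distrib,
    Finset.sum_add_distrib, h1]
  have h4 : ∑ k : Fin (2 * m), form m u (e k.rev) * D (e k) p = D u p := h2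
  rw [h4]
  simp only [← mul_assoc, ← Finset.sum_mul, h3]

/-- `(x, y) ↦ R(u, x, u, y)`. -/
def jacobiForm (q : QuadraticForm ℂ (so m)) (u : V m) : LinearMap.BilinForm ℂ (V m) :=
  q.polarBilin.compl₁₂ (bv m u) (bv m u)

theorem jacobiForm_apply (q : QuadraticForm ℂ (so m)) (u x y : V m) :
    jacobiForm q u x y = curv q u x u y := rfl

theorem jacobiForm_symm (q : QuadraticForm ℂ (so m)) (u x y : V m) :
    jacobiForm q u x y = jacobiForm q u y x := curv_symm _ _ _ _ _

theorem btrace_jacobiForm (q : QuadraticForm ℂ (so m)) (u : V m) :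
    btrace (jacobiForm q u) = ric q u u := rfl

theorem jacobiForm_self_left (q : QuadraticForm ℂ (so m)) (u x : V m) :
    jacobiForm q u u x = 0 := by simp [jacobiForm, bv_self]

theorem btrace_sub_smul (B : LinearMap.BilinForm ℂ (V m)) (c : ℂ) :
    btrace (B - c • form m) = btrace B - c * (2 * m) := by
  rw [← btrace_form]
  simp only [btrace, LinearMap.sub_apply, LinearMap.smul_apply, smul_eq_mul,
    Finset.sum_sub_distrib, Finset.mul_sum]

/-- On `u^⊥` the Jacobi form vanishes at isotropic vectors, so it is `c` times the form. Its trace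
is `ric q u u = 0`, which reads `(2m-2) c = 0` for `u` isotropic and `(2m-1) c = 0` for `u` of norm
1. -/
theorem jacobiForm_eq_zero_on_perp (hm : 4 ≤ m) {q : QuadraticForm ℂ (so m)}
    (hr : ∀ u, ric q u u = 0) {u : V m} (hu : u ≠ 0)
    (h : ∀ x, form m x u = 0 → form m x x = 0 → q (bv m u x) = 0)
    (hn : form m u u = 0 ∨ form m u u = 1) {x y : V m} (hx : form m x u = 0)
    (hy : form m y u = 0) : jacobiForm q u x y = 0 := by
  have hfr : finrank ℂ (ℂ ∙ u) ≤ 3 := by rw [finrank_span_singleton hu]; norm_num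
  have hmem : ∀ x, x ∈ (form m).orthogonal (ℂ ∙ u) ↔ form m x u = 0 := by
    intro x
    rw [mem_orthogonal_form]
    refine ⟨fun h => by rw [form_comm]; exact h u (Submodule.mem_span_singleton_self u),
      fun h s hs => ?_⟩
    obtain ⟨c, rfl⟩ := Submodule.mem_span_singleton.1 hs
    rw [LinearMap.map_smul₂, form_comm, h, smul_zero]
  obtain ⟨w, hw, z, hz, hww, hzz, hwz⟩ := exists_orthonormal_pair hm hfr
  obtain ⟨c, hc⟩ := bilin_eq_smul_of_isotropic (jacobiForm_symm q u) hw hz hww hzz hwz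
    (fun x hx hxx => by
      rw [jacobiForm_apply, curv_self, h x ((hmem x).1 hx) hxx, mul_zero])
  have hm' : (m : ℂ) - 1 ≠ 0 := by
    rw [sub_ne_zero]; norm_cast; omega
  have hm2 : 2 * (m : ℂ) - 1 ≠ 0 := by
    rw [sub_ne_zero]; norm_cast; omega
  have hD : ∀ x y, form m x u = 0 → form m y u = 0 → (jacobiForm q u - c • form m) x y = 0 := by
    intro x y hx hy
    rw [LinearMap.sub_apply, LinearMap.sub_apply, hc x ((hmem x).2 hx) y ((hmem y).2 hy)]
    simp
  have hc0 : c = 0 := by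
    rcases hn with hn | hn
    · obtain ⟨f, hf⟩ : ∃ p, form m p u = 1 := by
        have : ∃ p, form m p u ≠ 0 := by
          by_contra! h0
          exact hu (form_nondeg fun p => by rw [h0, map_zero])
        obtain ⟨p, hp⟩ := this
        exact ⟨(form m p u)⁻¹ • p, by simp [hp]⟩
      have t := btrace_of_vanishing hf hD
      rw [btrace_sub_smul, btrace_jacobiForm, hr] at t
      simp only [LinearMap.sub_apply, LinearMap.smul_apply, jacobiForm_self_left,
        jacobiForm_symm q u f u, hn, hf, form_comm u f, smul_eq_mul] at t
      have t2 : ((m : ℂ) - 1) * (2 * c) = 0 := by linear_combination - t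
      simpa [hm'] using t2
    · have t := btrace_of_vanishing hn hD
      rw [btrace_sub_smul, btrace_jacobiForm, hr] at t
      simp only [LinearMap.sub_apply, LinearMap.smul_apply, jacobiForm_self_left, hn,
        smul_eq_mul] at t
      have t2 : (2 * (m : ℂ) - 1) * c = 0 := by linear_combination - t
      simpa [hm2] using t2
  rw [hc x ((hmem x).2 hx) y ((hmem y).2 hy), hc0, zero_mul]

/-- A quadratic form of Weyl type is determined by its values on isotropic planes. -/
theorem weyl_eq_zero (hm : 4 ≤ m) {q : QuadraticForm ℂ (so m)} (hq : q ∈ weyl m)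
    (h : ∀ u v, form m u u = 0 → form m v v = 0 → form m u v = 0 → q (bv m u v) = 0) : q = 0 := by
  have hr : ∀ u, ric q u u = 0 := fun u => hq.2 u u
  -- Enlarge the set of planes in stages: isotropic `u` with `x ⊥ u`; then `u` of norm 1, using `s1`
  -- for isotropic vectors of `u^⊥`; then `u` of nonzero norm by scaling; then all.
  have s1 : ∀ u x, form m u u = 0 → form m x u = 0 → q (bv m u x) = 0 := by
    intro u x hu hx
    by_cases hu0 : u = 0
    · rw [hu0, map_zero, LinearMap.zero_apply, QuadraticMap.map_zero]
    have a := jacobiForm_eq_zero_on_perp hm hr hu0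
      (fun y hy hyy => h u y hu hyy (by rw [form_comm, hy])) (Or.inl hu) hx hx
    rw [jacobiForm_apply, curv_self] at a
    simpa using a
  have s2 : ∀ u x, form m u u = 1 → q (bv m u x) = 0 := by
    intro u x hu
    have hu0 : u ≠ 0 := fun h0 => by simp [h0] at hu
    have hx : form m (x - form m x u • u) u = 0 := by simp [hu]
    have a := jacobiForm_eq_zero_on_perp hm hr hu0
      (fun y hy hyy => by
        rw [bv_swap, QuadraticMap.map_neg]
        exact s1 y u hyy (by rw [form_comm, hy])) (Or.inr hu) hx hx
    rw [jacobiForm_apply, curv_self, map_sub, map_smul, bv_self, smul_zero, sub_zero] at a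
    simpa using a
  have s3 : ∀ u x, form m u u ≠ 0 → q (bv m u x) = 0 := by
    intro u x hu
    obtain ⟨y, hy, hyy⟩ := exists_form_self_eq_one (Submodule.mem_span_singleton_self u) hu
    obtain ⟨c, rfl⟩ := Submodule.mem_span_singleton.1 hy
    have hc : c ≠ 0 := fun h0 => by simp [h0] at hyy
    have a := s2 _ x hyy
    rw [LinearMap.map_smul₂, QuadraticMap.map_smul] at a
    simpa [hc] using a
  have s4 : ∀ u x, q (bv m u x) = 0 := by
    intro u x
    by_cases hu : form m u u = 0
    · by_cases hx : form m x x = 0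
      · by_cases hux : form m u x = 0
        · exact h u x hu hx hux
        -- `(u + x) ∧ x = u ∧ x`, and `u + x` has norm `2(u,x) ≠ 0`.
        · have a := s3 (u + x) x (by
            simp only [map_add, LinearMap.add_apply, hu, hx, form_comm x u]
            intro h0
            exact hux (by linear_combination h0 / 2))
          rwa [map_add, LinearMap.add_apply, bv_self, add_zero] at a
      · rw [bv_swap, QuadraticMap.map_neg]
        exact s3 x u hx
    · exact s3 u x hu
  refine eq_zero_of_curv fun u v x y => ?_
  have a := bianchi_of_vanishing s4 u v x y
  rw [hq.1] at a
  simpa using a.symm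

/-! ### The trace form -/

/-- The trace form of `so_{2m}`. -/
def traceForm (m : ℕ) : LinearMap.BilinForm ℂ (so m) :=
  LinearMap.mk₂ ℂ (fun X Y => LinearMap.trace ℂ (V m) (X.1 * Y.1))
    (by intros; simp [add_mul]) (by intros; simp) (by intros; simp [mul_add]) (by intros; simp)

theorem traceForm_apply (X Y : so m) :
    traceForm m X Y = LinearMap.trace ℂ (V m) (X.1 * Y.1) := rfl

theorem traceForm_comm (X Y : so m) : traceForm m X Y = traceForm m Y X :=
  LinearMap.trace_mul_comm _ _ _

theorem traceForm_lie (Z X Y : so m) : traceForm m ⁅Z, X⁆ Y = - traceForm m X ⁅Z, Y⁆ := by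
  have h := LinearMap.trace_mul_comm ℂ Z.1 (X.1 * Y.1)
  simp only [traceForm_apply, LieSubalgebra.coe_bracket, Ring.lie_def, sub_mul, mul_sub, map_sub,
    mul_assoc] at h ⊢
  linear_combination h

theorem traceForm_bv (u v : V m) (Y : so m) :
    traceForm m (bv m u v) Y = 2 * form m u (Y.1 v) := by
  have h : (bv m u v).1 * Y.1 = (form m u ∘ₗ Y.1).smulRight v - (form m v ∘ₗ Y.1).smulRight u := by
    refine LinearMap.ext fun z => ?_
    simp [bv_apply]
  rw [traceForm_apply, h, map_sub, LinearMap.trace_smulRight, LinearMap.trace_smulRight]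
  have := so_skew Y u v
  rw [form_comm] at this
  simp only [LinearMap.comp_apply]
  linear_combination - this

theorem traceForm_nondegenerate : (traceForm m).Nondegenerate := by
  have key : ∀ X : so m, (∀ Y, traceForm m Y X = 0) → X = 0 := by
    intro X hX
    apply Subtype.ext
    refine LinearMap.ext fun v => form_nondeg fun u => ?_
    have := hX (bv m u v)
    rw [traceForm_bv] at this
    simpa using this
  exact ⟨fun X hX => key X fun Y => by rw [traceForm_comm]; exact hX Y, key⟩

/-! ### The invariant pairing on quadratic forms -/

/-- The endomorphism attached to a quadratic form by the trace form. -/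
def toEndo (q : QuadraticForm ℂ (so m)) : Module.End ℂ (so m) :=
  ((traceForm m).toDual traceForm_nondegenerate).symm.toLinearMap ∘ₗ q.polarBilin

theorem traceForm_toEndo (q : QuadraticForm ℂ (so m)) (Y Z : so m) :
    traceForm m (toEndo q Y) Z = q.polarBilin Y Z :=
  LinearMap.BilinForm.apply_toDual_symm_apply (hB := traceForm_nondegenerate) ..

theorem eq_of_traceForm {X Y : so m} (h : ∀ Z, traceForm m X Z = traceForm m Y Z) : X = Y := by
  rw [← sub_eq_zero]
  exact traceForm_nondegenerate.1 _ fun Z => by rw [map_sub, LinearMap.sub_apply, h, sub_self]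

theorem toEndo_add (q r : QuadraticForm ℂ (so m)) : toEndo (q + r) = toEndo q + toEndo r := by
  refine LinearMap.ext fun Y => eq_of_traceForm fun Z => ?_
  rw [LinearMap.add_apply, map_add, LinearMap.add_apply]
  simp only [traceForm_toEndo]
  exact QuadraticMap.polar_add q r Y Z

theorem toEndo_smul (c : ℂ) (q : QuadraticForm ℂ (so m)) : toEndo (c • q) = c • toEndo q := by
  refine LinearMap.ext fun Y => eq_of_traceForm fun Z => ?_
  rw [LinearMap.smul_apply, map_smul, LinearMap.smul_apply]
  simp only [traceForm_toEndo]
  exact QuadraticMap.polar_smul q c Y Z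

theorem toEndo_lie (X : so m) (q : QuadraticForm ℂ (so m)) (Y : so m) :
    toEndo ⁅X, q⁆ Y = ⁅X, toEndo q Y⁆ - toEndo q ⁅X, Y⁆ := by
  refine eq_of_traceForm fun Z => ?_
  rw [map_sub, LinearMap.sub_apply, traceForm_lie]
  simp only [traceForm_toEndo, polar_lie]
  rw [polarBilin_comm q Z]
  ring

/-- The invariant bilinear form on quadratic forms. -/
def quadPairing (m : ℕ) :
    QuadraticForm ℂ (so m) →ₗ[ℂ] QuadraticForm ℂ (so m) →ₗ[ℂ] ℂ :=
  LinearMap.mk₂ ℂ (fun q r => LinearMap.trace ℂ (so m) (toEndo q * toEndo r))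
    (by intros; simp [toEndo_add, add_mul]) (by intros; simp [toEndo_smul])
    (by intros; simp [toEndo_add, mul_add]) (by intros; simp [toEndo_smul])

theorem quadPairing_apply (q r : QuadraticForm ℂ (so m)) :
    quadPairing m q r = LinearMap.trace ℂ (so m) (toEndo q * toEndo r) := rfl

theorem quadPairing_lie (X : so m) (q r : QuadraticForm ℂ (so m)) :
    quadPairing m ⁅X, q⁆ r = - quadPairing m q ⁅X, r⁆ := by
  have h : ∀ p : QuadraticForm ℂ (so m), toEndo ⁅X, p⁆ =
      LieModule.toEnd ℂ (so m) (so m) X * toEndo p -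
        toEndo p * LieModule.toEnd ℂ (so m) (so m) X :=
    fun p => LinearMap.ext fun Y => toEndo_lie X p Y
  have h2 := LinearMap.trace_mul_comm ℂ (LieModule.toEnd ℂ (so m) (so m) X)
    (toEndo q * toEndo r)
  simp only [quadPairing_apply, h, sub_mul, mul_sub, map_sub, mul_assoc] at h2 ⊢
  linear_combination h2

/-- The square of the linear form `Y ↦ tr (X Y)`. -/
def sqForm (X : so m) : QuadraticForm ℂ (so m) :=
  QuadraticMap.linMulLin (traceForm m X) (traceForm m X)

theorem sqForm_apply (X Y : so m) : sqForm X Y = traceForm m X Y * traceForm m X Y := rfl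

theorem polarBilin_sqForm (X Y Z : so m) :
    (sqForm X).polarBilin Y Z = 2 * traceForm m X Y * traceForm m X Z := by
  rw [QuadraticMap.polarBilin_apply_apply, QuadraticMap.polar, sqForm_apply, sqForm_apply,
    sqForm_apply, map_add]
  ring

/-- `toEndo (sqForm X)` is the rank-one map `Y ↦ 2 tr(XY) X`, so pairing with a square is evaluation
at `X`, up to a constant. -/
theorem quadPairing_sqForm (q : QuadraticForm ℂ (so m)) (X : so m) :
    quadPairing m q (sqForm X) = 4 * q X := by
  have h : toEndo (sqForm X) = ((2 : ℂ) • traceForm m X).smulRight X := by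
    refine LinearMap.ext fun Y => eq_of_traceForm fun Z => ?_
    rw [traceForm_toEndo, polarBilin_sqForm]
    simp
  have h2 : toEndo q * toEndo (sqForm X) = ((2 : ℂ) • traceForm m X).smulRight (toEndo q X) := by
    rw [h]
    refine LinearMap.ext fun Y => ?_
    simp
  rw [quadPairing_apply, h2, LinearMap.trace_smulRight, LinearMap.smul_apply, traceForm_comm,
    traceForm_toEndo, polarBilin_self, smul_eq_mul]
  ring

/-! ### Irreducibility of the Weyl-type forms -/

section Irreducible

variable {a b : V m}

/-- The bivector of an isotropic plane is an extremal element: its `ad` squared takes values in its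
own line. -/
theorem lie_lie_bv (haa : form m a a = 0) (hbb : form m b b = 0) (hab : form m a b = 0)
    (Z : so m) : ⁅bv m a b, ⁅bv m a b, Z⁆⁆ = - traceForm m (bv m a b) Z • bv m a b := by
  have h : (LieModule.toEnd ℂ (so m) (so m) (bv m a b)) ∘ₗ
      (LieModule.toEnd ℂ (so m) (so m) (bv m a b)) =
      (- traceForm m (bv m a b)).smulRight (bv m a b) := by
    apply so_linearMap_ext
    intro u v
    simp only [LinearMap.comp_apply, LieModule.toEnd_apply_apply, lie_bv, map_add,
      bv_sq_zero haa hbb hab, map_zero, LinearMap.zero_apply, LinearMap.smulRight_apply,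
      LinearMap.neg_apply, traceForm_bv]
    simp only [bv_apply, map_sub, map_smul, LinearMap.sub_apply, LinearMap.smul_apply, bv_self,
      smul_zero, smul_eq_mul, bv_swap b a, form_comm u b, form_comm v b]
    module
  exact LinearMap.congr_fun h Z

/-- Since `ad(a ∧ b)³ = 0`, the fourth derivative of `q(Z,Z)` keeps only the term with two
derivatives on each argument, whence the binomial coefficient 6. -/
theorem lie_pow_four (haa : form m a a = 0) (hbb : form m b b = 0) (hab : form m a b = 0)
    (q : QuadraticForm ℂ (so m)) :
    ⁅bv m a b, ⁅bv m a b, ⁅bv m a b, ⁅bv m a b, q⁆⁆⁆⁆ =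
      (6 * q (bv m a b)) • sqForm (bv m a b) := by
  ext Z
  have h := polarBilin_self ⁅bv m a b, ⁅bv m a b, ⁅bv m a b, ⁅bv m a b, q⁆⁆⁆⁆ Z
  rw [polar_lie_lie, polar_lie_lie, polar_lie_lie, polar_lie_lie] at h
  simp only [lie_lie_bv haa hbb hab, lie_smul, lie_self, smul_zero, lie_zero, map_zero, map_smul,
    LinearMap.smul_apply, LinearMap.zero_apply, smul_eq_mul, polarBilin_self] at h
  rw [_root_.smul_apply, sqForm_apply, smul_eq_mul]
  linear_combination - h / 2

theorem bv_ne_zero (ha : a ≠ 0) (hb : b ∉ Submodule.span ℂ {a}) : bv m a b ≠ 0 := by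
  intro h
  obtain ⟨p, hp⟩ : ∃ p, form m p a ≠ 0 := by
    by_contra! h0
    exact ha (form_nondeg fun p => by rw [h0, map_zero])
  have h1 : (bv m a b).1 p = 0 := by rw [h]; rfl
  rw [bv_apply, sub_eq_zero, form_comm a] at h1
  refine hb (Submodule.mem_span_singleton.2 ⟨(form m p a)⁻¹ * form m b p, ?_⟩)
  rw [mul_smul, ← h1, inv_smul_smul₀ hp]

/-- Decompose the square of a linear form nonzero at `a ∧ b`: the `Vdec` part vanishes on
decomposables and the `Viso` part on isotropic planes, so the Weyl part carries the whole value. -/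
theorem exists_mem_weyl_ne_zero (hm : 4 ≤ m) (ha : a ≠ 0) (hb : b ∉ Submodule.span ℂ {a})
    (haa : form m a a = 0) (hbb : form m b b = 0) (hab : form m a b = 0) :
    ∃ q ∈ weyl m, q (bv m a b) ≠ 0 := by
  obtain ⟨Z, hZ⟩ : ∃ Z, traceForm m Z (bv m a b) ≠ 0 := by
    by_contra! h0
    exact bv_ne_zero ha hb (traceForm_nondegenerate.2 _ h0)
  obtain ⟨c, hc, d, hd, i, hi, h⟩ := exists_decomposition hm (sqForm Z)
  refine ⟨c, hc, fun h0 => hZ ?_⟩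
  have h1 : c (bv m a b) + d (bv m a b) + i (bv m a b) = sqForm Z (bv m a b) := by rw [← h]; rfl
  obtain ⟨k, hs, hk⟩ := mem_Viso.1 hi
  have h2 := curv_self i a b
  rw [hk, kn, haa, hbb, hab, form_comm b a, hab] at h2
  rw [h0, mem_Vdec.1 hd, sqForm_apply] at h1
  have h3 : traceForm m Z (bv m a b) * traceForm m Z (bv m a b) = 0 := by
    linear_combination - h1 - h2 / 2
  simpa using h3

theorem exists_ne_zero_of_le_weyl (hm : 4 ≤ m) (ha : a ≠ 0) (hb : b ∉ Submodule.span ℂ {a})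
    (haa : form m a a = 0) (hbb : form m b b = 0) (hab : form m a b = 0)
    {N : LieSubmodule ℂ (so m) (QuadraticForm ℂ (so m))} (hN : N ≤ weyl m) (hN0 : N ≠ ⊥) :
    ∃ q ∈ N, q (bv m a b) ≠ 0 := by
  by_contra! h
  refine hN0 ((LieSubmodule.eq_bot_iff N).2 fun q hq => weyl_eq_zero hm (hN hq) ?_)
  intro u v huu hvv huv
  exact vanishAt_of_isotropic hm (J := N) (a := a) (b := b) h ha haa hbb hab hb huu hvv huv q hq

/-- Four applications of `a ∧ b` to a form not vanishing there give a nonzero multiple of this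
vector, which is thus common to all nonzero subrepresentations of `weyl m`. -/
theorem sqForm_mem_of_le_weyl (hm : 4 ≤ m) (ha : a ≠ 0) (hb : b ∉ Submodule.span ℂ {a})
    (haa : form m a a = 0) (hbb : form m b b = 0) (hab : form m a b = 0)
    {N : LieSubmodule ℂ (so m) (QuadraticForm ℂ (so m))} (hN : N ≤ weyl m) (hN0 : N ≠ ⊥) :
    sqForm (bv m a b) ∈ N := by
  obtain ⟨q, hq, hq0⟩ := exists_ne_zero_of_le_weyl hm ha hb haa hbb hab hN hN0
  have h := N.lie_mem (x := bv m a b) (N.lie_mem (x := bv m a b) (N.lie_mem (x := bv m a b)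
    (N.lie_mem (x := bv m a b) hq)))
  have h2 : (6 * q (bv m a b)) • sqForm (bv m a b) ∈ N := by
    rw [← lie_pow_four haa hbb hab]; exact h
  have h6 : 6 * q (bv m a b) ≠ 0 := mul_ne_zero (by norm_num) hq0
  have h3 := N.smul_mem (6 * q (bv m a b))⁻¹ h2
  rwa [inv_smul_smul₀ h6] at h3

instance : FiniteDimensional ℂ (QuadraticForm ℂ (so m)) := by
  let f : QuadraticForm ℂ (so m) →ₗ[ℂ] Module.End ℂ (so m) :=
    { toFun := toEndo
      map_add' := toEndo_add
      map_smul' := toEndo_smul }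
  refine FiniteDimensional.of_injective f ?_
  rw [injective_iff_map_eq_zero]
  intro q hq
  refine eq_zero_of_curv fun u v x y => ?_
  rw [curv, ← traceForm_toEndo]
  change traceForm m (f q (bv m u v)) _ = 0
  rw [hq, LinearMap.zero_apply, map_zero, LinearMap.zero_apply]

/-- The orthogonal complement of a subrepresentation inside the Weyl-type forms. -/
def weylPerp (N : LieSubmodule ℂ (so m) (QuadraticForm ℂ (so m))) :
    LieSubmodule ℂ (so m) (QuadraticForm ℂ (so m)) where
  carrier := {r | r ∈ weyl m ∧ ∀ q ∈ N, quadPairing m q r = 0}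
  add_mem' := fun {r s} hr hs => ⟨(weyl m).add_mem hr.1 hs.1, fun q hq => by
    rw [map_add, hr.2 q hq, hs.2 q hq, add_zero]⟩
  zero_mem' := ⟨(weyl m).zero_mem, fun q _ => map_zero _⟩
  smul_mem' := fun c {r} hr => ⟨(weyl m).smul_mem c hr.1, fun q hq => by
    rw [map_smul, hr.2 q hq, smul_zero]⟩
  lie_mem := fun {X r} hr => ⟨(weyl m).lie_mem hr.1, fun q hq => by
    have h := quadPairing_lie X q r
    rw [hr.2 _ (N.lie_mem hq)] at h
    linear_combination h⟩

theorem eq_weyl_of_ne_bot (hm : 4 ≤ m) (ha : a ≠ 0) (hb : b ∉ Submodule.span ℂ {a})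
    (haa : form m a a = 0) (hbb : form m b b = 0) (hab : form m a b = 0)
    {N : LieSubmodule ℂ (so m) (QuadraticForm ℂ (so m))} (hN : N ≤ weyl m) (hN0 : N ≠ ⊥) :
    N = weyl m := by
  have hP : weylPerp N = ⊥ := by
    by_contra hP
    obtain ⟨q, hq, hq0⟩ := exists_ne_zero_of_le_weyl hm ha hb haa hbb hab hN hN0
    have h := (sqForm_mem_of_le_weyl hm ha hb haa hbb hab (N := weylPerp N)
      (fun r hr => hr.1) hP).2 q hq
    rw [quadPairing_sqForm] at h
    simp [hq0] at h
  -- With trivial orthogonal complement, `weyl m` embeds in the dual of `N`, so its dimension is at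
  -- most that of `N`.
  let f : (weyl m).toSubmodule →ₗ[ℂ] Dual ℂ N.toSubmodule :=
    ((quadPairing m).compl₁₂ N.toSubmodule.subtype (weyl m).toSubmodule.subtype).flip
  have hf : Function.Injective f := by
    rw [injective_iff_map_eq_zero]
    intro r hr
    have h : (r : QuadraticForm ℂ (so m)) ∈ weylPerp N :=
      ⟨r.2, fun q hq => LinearMap.congr_fun hr ⟨q, hq⟩⟩
    rw [hP, LieSubmodule.mem_bot] at h
    exact Subtype.ext h
  have hle := LinearMap.finrank_le_finrank_of_injective hf
  rw [Subspace.dual_finrank_eq] at hle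
  have := Submodule.eq_of_le_of_finrank_le (S₁ := N.toSubmodule) (S₂ := (weyl m).toSubmodule) hN hle
  exact LieSubmodule.toSubmodule_injective this

theorem weyl_isIrreducible (hm : 4 ≤ m) (ha : a ≠ 0) (hb : b ∉ Submodule.span ℂ {a})
    (haa : form m a a = 0) (hbb : form m b b = 0) (hab : form m a b = 0) :
    LieModule.IsIrreducible ℂ (so m) (weyl m) := by
  obtain ⟨q, hq, hq0⟩ := exists_mem_weyl_ne_zero hm ha hb haa hbb hab
  have : Nontrivial (weyl m) := ⟨⟨q, hq⟩, 0, fun h => hq0 (by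
    have : q = 0 := congrArg Subtype.val h
    rw [this]; rfl)⟩
  refine LieModule.IsIrreducible.mk fun N hN => ?_
  have h1 : N.map (weyl m).incl ≤ weyl m := by
    rintro _ ⟨x, -, rfl⟩
    exact x.2
  have h2 : N.map (weyl m).incl ≠ ⊥ := by
    intro h
    apply hN
    rw [LieSubmodule.eq_bot_iff] at h ⊢
    intro x hx
    exact Subtype.ext (h x ((LieSubmodule.mem_map _).2 ⟨x, hx, rfl⟩))
  have h3 := eq_weyl_of_ne_bot hm ha hb haa hbb hab h1 h2
  rw [eq_top_iff]
  intro x _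
  have h4 : (x : QuadraticForm ℂ (so m)) ∈ N.map (weyl m).incl := by rw [h3]; exact x.2
  obtain ⟨y, hy, hyx⟩ := (LieSubmodule.mem_map _).1 h4
  have : y = x := Subtype.ext hyx
  rwa [← this]

end Irreducible

end SOQuad

namespace SOQuad

/-! ### Duals and products of representations -/

section General

variable {K L M N : Type*} [Field K] [LieRing L] [AddCommGroup M] [Module K M]
  [LieRingModule L M] [AddCommGroup N] [Module K N] [LieRingModule L N]

instance prodLieRingModule : LieRingModule L (M × N) where
  bracket X p := (⁅X, p.1⁆, ⁅X, p.2⁆)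
  add_lie X Y p := Prod.ext (add_lie X Y p.1) (add_lie X Y p.2)
  lie_add X p q := Prod.ext (lie_add X p.1 q.1) (lie_add X p.2 q.2)
  leibniz_lie X Y p := Prod.ext (leibniz_lie X Y p.1) (leibniz_lie X Y p.2)

theorem prod_lie (X : L) (p : M × N) : ⁅X, p⁆ = (⁅X, p.1⁆, ⁅X, p.2⁆) := rfl

instance prodLieModule [LieAlgebra K L] [LieModule K L M] [LieModule K L N] : LieModule K L (M × N) where
  smul_lie c X p := Prod.ext (smul_lie c X p.1) (smul_lie c X p.2)
  lie_smul c X p := Prod.ext (lie_smul c X p.1) (lie_smul c X p.2)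

/-- A bijective homomorphism of Lie modules is an equivalence. -/
def lieModuleEquivOfBijective (f : M →ₗ⁅K,L⁆ N) (h : Function.Bijective f) : M ≃ₗ⁅K,L⁆ N :=
  { f with
    invFun := (Equiv.ofBijective f h).symm
    left_inv := (Equiv.ofBijective f h).symm_apply_apply
    right_inv := (Equiv.ofBijective f h).apply_symm_apply }

/-- Annihilators match subrepresentations of the dual with those of `M`, by finite dimensionality.
-/
theorem dual_isIrreducible [LieAlgebra K L] [LieModule K L M] [FiniteDimensional K M] (h : LieModule.IsIrreducible K L M) :
    LieModule.IsIrreducible K L (Dual K M) := by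
  have : Nontrivial M := LieModule.nontrivial_of_isIrreducible K L M
  refine LieModule.IsIrreducible.mk fun P hP => ?_
  let Q : LieSubmodule K L M :=
    { P.toSubmodule.dualCoannihilator with
      lie_mem := fun {X x} hx => by
        change ⁅X, x⁆ ∈ P.toSubmodule.dualCoannihilator
        change x ∈ P.toSubmodule.dualCoannihilator at hx
        rw [Submodule.mem_dualCoannihilator] at hx ⊢
        intro f hf
        have h1 := hx _ (P.lie_mem (x := X) hf)
        rw [Module.Dual.lie_apply] at h1
        simpa using h1 }
  have hQ : Q.toSubmodule = P.toSubmodule.dualCoannihilator := rfl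
  have hPQ := Subspace.dualCoannihilator_dualAnnihilator_eq (W := P.toSubmodule)
  rw [← hQ] at hPQ
  apply LieSubmodule.toSubmodule_injective
  rcases eq_bot_or_eq_top Q with h0 | h0
  · rw [← hPQ, h0]
    simp
  · exfalso
    apply hP
    apply LieSubmodule.toSubmodule_injective
    rw [← hPQ, h0]
    simp

/-- The transpose of an equivalence of Lie modules. -/
def dualLieEquiv [LieAlgebra K L] [LieModule K L M] [LieModule K L N]
    (f : M ≃ₗ⁅K,L⁆ N) : Dual K N ≃ₗ⁅K,L⁆ Dual K M :=
  lieModuleEquivOfBijective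
    { f.toLinearEquiv.dualMap with
      map_lie' := fun {X g} => LinearMap.ext fun x => by
        change ⁅X, g⁆ (f x) = ⁅X, f.toLinearEquiv.dualMap g⁆ x
        rw [Module.Dual.lie_apply, Module.Dual.lie_apply]
        exact congrArg (fun z => - g z) (f.toLieModuleHom.map_lie X x).symm }
    f.toLinearEquiv.dualMap.bijective

/-- A finite-dimensional Lie module is isomorphic to its double dual. -/
def doubleDualLieEquiv [LieAlgebra K L] [LieModule K L M] [FiniteDimensional K M] :
    M ≃ₗ⁅K,L⁆ Dual K (Dual K M) :=
  lieModuleEquivOfBijective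
    { (Module.evalEquiv K M).toLinearMap with
      map_lie' := fun {X x} => LinearMap.ext fun f => by
        change f ⁅X, x⁆ = ⁅X, Module.evalEquiv K M x⁆ f
        rw [Module.Dual.lie_apply, Module.evalEquiv_apply, Module.Dual.eval_apply,
          Module.Dual.lie_apply, neg_neg] }
    (Module.evalEquiv K M).bijective

/-- Goursat's argument: by irreducibility both projections of `G` are onto, and its intersections
with the two factors are zero, so `G` is the graph of an isomorphism. -/
theorem nonempty_equiv_of_graph (hM : LieModule.IsIrreducible K L M)
    (hN : LieModule.IsIrreducible K L N) {x : M} {y : N} (hx : x ≠ 0) (hy : y ≠ 0)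
    {G : LieSubmodule K L (M × N)} (hG : (x, y) ∈ G) (h1 : (x, (0 : N)) ∉ G)
    (h2 : ((0 : M), y) ∉ G) : Nonempty (M ≃ₗ⁅K,L⁆ N) := by
  let p1 : G →ₗ⁅K,L⁆ M :=
    { (LinearMap.fst K M N) ∘ₗ G.toSubmodule.subtype with map_lie' := rfl }
  let p2 : G →ₗ⁅K,L⁆ N :=
    { (LinearMap.snd K M N) ∘ₗ G.toSubmodule.subtype with map_lie' := rfl }
  let i1 : M →ₗ⁅K,L⁆ M × N :=
    { LinearMap.inl K M N with
      map_lie' := fun {X z} => Prod.ext rfl (lie_zero X).symm }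
  let i2 : N →ₗ⁅K,L⁆ M × N :=
    { LinearMap.inr K M N with
      map_lie' := fun {X z} => Prod.ext (lie_zero X).symm rfl }
  have s1 : Function.Surjective p1 := by
    rw [← LieModuleHom.range_eq_top]
    refine (eq_bot_or_eq_top _).resolve_left fun h0 => hx ?_
    have : x ∈ p1.range := (LieModuleHom.mem_range _ _).2 ⟨⟨(x, y), hG⟩, rfl⟩
    rwa [h0, LieSubmodule.mem_bot] at this
  have s2 : Function.Surjective p2 := by
    rw [← LieModuleHom.range_eq_top]
    refine (eq_bot_or_eq_top _).resolve_left fun h0 => hy ?_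
    have : y ∈ p2.range := (LieModuleHom.mem_range _ _).2 ⟨⟨(x, y), hG⟩, rfl⟩
    rwa [h0, LieSubmodule.mem_bot] at this
  have c1 : G.comap i1 = ⊥ := by
    refine (eq_bot_or_eq_top _).resolve_right fun h0 => h1 ?_
    have : x ∈ G.comap i1 := by rw [h0]; exact LieSubmodule.mem_top x
    exact this
  have c2 : G.comap i2 = ⊥ := by
    refine (eq_bot_or_eq_top _).resolve_right fun h0 => h2 ?_
    have : y ∈ G.comap i2 := by rw [h0]; exact LieSubmodule.mem_top y
    exact this
  have j1 : Function.Injective p1 := by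
    rw [← LieModuleHom.ker_eq_bot, LieSubmodule.eq_bot_iff]
    rintro ⟨⟨z, t⟩, hz⟩ hk
    obtain rfl : z = 0 := hk
    have : t ∈ G.comap i2 := hz
    rw [c2, LieSubmodule.mem_bot] at this
    subst this
    rfl
  have j2 : Function.Injective p2 := by
    rw [← LieModuleHom.ker_eq_bot, LieSubmodule.eq_bot_iff]
    rintro ⟨⟨z, t⟩, hz⟩ hk
    obtain rfl : t = 0 := hk
    have : z ∈ G.comap i1 := hz
    rw [c1, LieSubmodule.mem_bot] at this
    subst this
    rfl
  exact ⟨(lieModuleEquivOfBijective p1 ⟨j1, s1⟩).symm.trans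
    (lieModuleEquivOfBijective p2 ⟨j2, s2⟩)⟩

end General

variable {m : ℕ}

/-! ### Uniqueness of highest weight representations -/

/-- The eigenvalues of the grading element. -/
def grading (m : ℕ) (i : Fin (2 * m)) : ℂ := 2 * m - 1 - 2 * (i : ℕ)

theorem grading_rev (i : Fin (2 * m)) : grading m i.rev = - grading m i := by
  rw [grading, grading, Fin.val_rev, Nat.cast_sub (by omega)]
  push_cast
  ring

/-- The grading element of `so_{2m}`. -/
def gradingElt (m : ℕ) : so m :=
  ⟨LinearMap.pi fun i => grading m i • LinearMap.proj i, by
    rw [mem_so_iff]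
    intro v w
    simp only [form_apply, LinearMap.pi_apply, LinearMap.smul_apply, LinearMap.proj_apply,
      smul_eq_mul, grading_rev, ← Finset.sum_neg_distrib]
    exact Finset.sum_congr rfl fun i _ => by ring⟩

theorem gradingElt_apply_e (i : Fin (2 * m)) : (gradingElt m).1 (e i) = grading m i • e i := by
  ext j
  by_cases h : j = i
  · subst h
    simp [gradingElt]
  · simp [gradingElt, h]

theorem gradingElt_mem : gradingElt m ∈ cartan m := by
  intro i j hij
  rw [entry_eq, gradingElt_apply_e]
  simp [hij]

/-- The degree is `2(2m - 1 - i - j)` with indices from 0: positive, zero or negative as `e_i ∧ e_j`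
is strictly upper triangular, diagonal or strictly lower triangular. -/
theorem gradingElt_lie (i j : Fin (2 * m)) :
    ⁅gradingElt m, bv m (e i) (e j)⁆ = (grading m i + grading m j) • bv m (e i) (e j) := by
  rw [lie_bv, gradingElt_apply_e, gradingElt_apply_e, map_smul, map_smul, LinearMap.smul_apply,
    add_smul]

theorem entry_bv (i j k l : Fin (2 * m)) :
    entry (bv m (e i) (e j)) k l =
      (if i = l.rev then 1 else 0) * (e j : V m) k - (if j = l.rev then 1 else 0) * (e i : V m) k := by
  rw [entry_eq, bv_apply, form_e_e, form_e_e]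
  rfl

theorem bv_mem_cartan {i j : Fin (2 * m)} (h : (i : ℕ) + j = 2 * m - 1) :
    bv m (e i) (e j) ∈ cartan m := by
  intro k l hkl
  have hj : j = i.rev := Fin.ext (by rw [Fin.val_rev]; omega)
  subst hj
  rw [entry_bv]
  have h1 : ¬ (i = l.rev ∧ k = i.rev) := fun ⟨a, b⟩ => hkl (by rw [b, a, Fin.rev_rev])
  have h2 : ¬ (i.rev = l.rev ∧ k = i) := fun ⟨a, b⟩ => hkl (by rw [b, Fin.rev_injective a])
  simp only [Pi.single_apply, ite_mul, one_mul, zero_mul, ← ite_and, h1, h2, if_false, sub_self]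

theorem bv_mem_nilp {i j : Fin (2 * m)} (h : (i : ℕ) + j < 2 * m - 1) :
    bv m (e i) (e j) ∈ nilp m := by
  intro k l hkl
  rw [entry_bv]
  have hkl' : (l : ℕ) ≤ k := hkl
  have h1 : ¬ (i = l.rev ∧ k = j) := fun ⟨a, b⟩ => by
    have := congrArg Fin.val a
    rw [Fin.val_rev] at this
    subst b
    omega
  have h2 : ¬ (j = l.rev ∧ k = i) := fun ⟨a, b⟩ => by
    have := congrArg Fin.val a
    rw [Fin.val_rev] at this
    subst b
    omega
  simp only [Pi.single_apply, ite_mul, one_mul, zero_mul, ← ite_and, h1, h2, if_false, sub_self]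

section HighestWeight

variable {M : Type*} [AddCommGroup M] [Module ℂ M] [LieRingModule (so m) M]
  [LieModule ℂ (so m) M]

/-- Stability under the strictly lower triangular root vectors. -/
def LowerStable (S : Submodule ℂ M) : Prop :=
  ∀ i j : Fin (2 * m), 2 * m - 1 < (i : ℕ) + j → ∀ s ∈ S, ⁅bv m (e i) (e j), s⁆ ∈ S

/-- Replaces the Poincaré–Birkhoff–Witt statement that `v` generates its module under lowering
operators alone. Let `T` be the least lower-stable subspace containing `v`. The `s ∈ T` with `X s ∈
T` for all `X` form a lower-stable subspace containing `v`, by `X(Ys) = [X,Y]s + Y(Xs)`; so `T` is a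
submodule. -/
theorem lieSpan_le_of_lowerStable {μ : Dual ℂ (cartan m)} {v : M}
    (hH : ∀ H : cartan m, ⁅(H : so m), v⁆ = μ H • v) (hn : ∀ X ∈ nilp m, ⁅X, v⁆ = 0)
    {S : Submodule ℂ M} (hv : v ∈ S) (hS : LowerStable (m := m) S) :
    (LieSubmodule.lieSpan ℂ (so m) {v}).toSubmodule ≤ S := by
  set T : Submodule ℂ M := sInf {S | v ∈ S ∧ LowerStable (m := m) S} with hT
  have hTv : v ∈ T := Submodule.mem_sInf.2 fun S hS => hS.1
  have hTl : LowerStable (m := m) T := fun i j hij s hs =>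
    Submodule.mem_sInf.2 fun S hS => hS.2 i j hij s (Submodule.mem_sInf.1 hs S hS)
  let T' : Submodule ℂ M :=
    { carrier := {s | s ∈ T ∧ ∀ X : so m, ⁅X, s⁆ ∈ T}
      add_mem' := fun {a b} ha hb => ⟨T.add_mem ha.1 hb.1, fun X => by
        rw [lie_add]; exact T.add_mem (ha.2 X) (hb.2 X)⟩
      zero_mem' := ⟨T.zero_mem, fun X => by rw [lie_zero]; exact T.zero_mem⟩
      smul_mem' := fun c {a} ha => ⟨T.smul_mem c ha.1, fun X => by
        rw [lie_smul]; exact T.smul_mem c (ha.2 X)⟩ }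
  have ind : ∀ s, (∀ i j, ⁅bv m (e i) (e j), s⁆ ∈ T) → ∀ X : so m, ⁅X, s⁆ ∈ T := by
    intro s hs X
    induction X using so_induction with
    | h0 => rw [zero_lie]; exact T.zero_mem
    | hadd X Y hX hY => rw [add_lie]; exact T.add_mem hX hY
    | hsmul c X hX => rw [smul_lie]; exact T.smul_mem c hX
    | hbv i j => exact hs i j
  have hT'v : v ∈ T' := by
    refine ⟨hTv, ind v fun i j => ?_⟩
    rcases lt_trichotomy ((i : ℕ) + j) (2 * m - 1) with h | h | h
    · rw [hn _ (bv_mem_nilp h)]; exact T.zero_mem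
    · rw [hH ⟨_, bv_mem_cartan h⟩]; exact T.smul_mem _ hTv
    · exact hTl i j h v hTv
  have hT'l : LowerStable (m := m) T' := by
    intro i j hij s hs
    refine ⟨hTl i j hij s hs.1, fun X => ?_⟩
    rw [leibniz_lie]
    exact T.add_mem (hs.2 _) (hTl i j hij _ (hs.2 X))
  have hTT' : T ≤ T' := sInf_le ⟨hT'v, hT'l⟩
  let T'' : LieSubmodule ℂ (so m) M :=
    { T with lie_mem := fun {X s} hs => (hTT' hs).2 X }
  have h1 : LieSubmodule.lieSpan ℂ (so m) {v} ≤ T'' :=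
    LieSubmodule.lieSpan_le.2 (Set.singleton_subset_iff.2 hTv)
  exact le_trans (show (LieSubmodule.lieSpan ℂ (so m) {v}).toSubmodule ≤ T from h1)
    (sInf_le ⟨hv, hS⟩)

/-- Lowering operators strictly decrease the grading eigenvalue, so the generated module lies in `ℂ
v` plus lower eigenspaces, which meet the top eigenspace only in 0. -/
theorem mem_span_of_mem_lieSpan {μ : Dual ℂ (cartan m)} {v : M}
    (hH : ∀ H : cartan m, ⁅(H : so m), v⁆ = μ H • v) (hn : ∀ X ∈ nilp m, ⁅X, v⁆ = 0)
    {x : M} (hx : x ∈ LieSubmodule.lieSpan ℂ (so m) {v})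
    (hxH : ⁅gradingElt m, x⁆ = μ ⟨gradingElt m, gradingElt_mem⟩ • x) :
    x ∈ Submodule.span ℂ {v} := by
  set lam := μ ⟨gradingElt m, gradingElt_mem⟩ with hlam
  set f : Module.End ℂ M := LieModule.toEnd ℂ (so m) M (gradingElt m) with hf
  set A : Submodule ℂ M := ⨆ k : ℕ, f.eigenspace (lam - 2 * (k + 1)) with hA
  have hgr : ∀ i j : Fin (2 * m), 2 * m - 1 < (i : ℕ) + j → ∃ k : ℕ,
      grading m i + grading m j = - 2 * (k + 1) := by
    intro i j hij
    -- The subtraction is not truncated, since `i + j ≥ 2m`.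
    refine ⟨(i : ℕ) + j - 2 * m, ?_⟩
    rw [Nat.cast_sub (by omega), grading, grading]
    push_cast
    ring
  have hlow : ∀ (i j : Fin (2 * m)) (ν : ℂ), ∀ s ∈ f.eigenspace ν,
      ⁅bv m (e i) (e j), s⁆ ∈ f.eigenspace (ν + (grading m i + grading m j)) := by
    intro i j ν s hs
    rw [Module.End.mem_eigenspace_iff] at hs ⊢
    change ⁅gradingElt m, s⁆ = ν • s at hs
    change ⁅gradingElt m, ⁅bv m (e i) (e j), s⁆⁆ = _
    rw [leibniz_lie, gradingElt_lie, smul_lie, hs, lie_smul, ← add_smul, add_comm]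
  have hS : LowerStable (m := m) (Submodule.span ℂ {v} ⊔ A) := by
    intro i j hij s hs
    obtain ⟨k, hk⟩ := hgr i j hij
    refine Submodule.mem_sup_right ?_
    obtain ⟨y, hy, a, ha, rfl⟩ := Submodule.mem_sup.1 hs
    rw [lie_add]
    refine A.add_mem ?_ ?_
    · obtain ⟨c, rfl⟩ := Submodule.mem_span_singleton.1 hy
      rw [lie_smul]
      refine A.smul_mem c (Submodule.mem_iSup_of_mem k ?_)
      have := hlow i j lam v (Module.End.mem_eigenspace_iff.2 (hH ⟨_, gradingElt_mem⟩))
      rw [hk] at this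
      convert this using 2
      ring
    · induction ha using Submodule.iSup_induction' with
      | zero => rw [lie_zero]; exact A.zero_mem
      | add a b _ _ ha hb =>
        rw [lie_add]
        exact A.add_mem (ha (Submodule.mem_sup.2 ⟨y, hy, a, by assumption, rfl⟩))
          (hb (Submodule.mem_sup.2 ⟨y, hy, b, by assumption, rfl⟩))
      | mem l a ha =>
        refine Submodule.mem_iSup_of_mem (k + l + 1) ?_
        have := hlow i j _ a ha
        rw [hk] at this
        convert this using 2
        push_cast
        ring
  have h1 := lieSpan_le_of_lowerStable hH hn (Submodule.mem_sup_left
    (Submodule.mem_span_singleton_self v)) hS hx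
  obtain ⟨y, hy, a, ha, rfl⟩ := Submodule.mem_sup.1 h1
  have hya : f y = lam • y := by
    obtain ⟨c, rfl⟩ := Submodule.mem_span_singleton.1 hy
    rw [map_smul, smul_comm]
    exact congrArg (c • ·) (hH ⟨_, gradingElt_mem⟩)
  have haH : a ∈ f.eigenspace lam := by
    rw [Module.End.mem_eigenspace_iff]
    change f (y + a) = _ at hxH
    rw [map_add, hya, smul_add] at hxH
    exact add_left_cancel hxH
  have hdis := f.eigenspaces_iSupIndep lam
  have hle : A ≤ ⨆ j, ⨆ (_ : j ≠ lam), f.eigenspace j := by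
    refine iSup_le fun k => le_iSup₂_of_le (lam - 2 * (k + 1)) (fun h => ?_) le_rfl
    have h2 : ((k : ℂ) + 1) = 0 := by linear_combination - h / 2
    exact Nat.cast_add_one_ne_zero k h2
  have ha0 : a = 0 := Submodule.disjoint_def.1 hdis a haH (hle ha)
  rw [ha0, add_zero]
  exact hy

end HighestWeight

/-- Take the submodule of `M × N` generated by `(x, y)`. If it contained `(x, 0)` or `(0, y)`, that
vector, having the same grading eigenvalue, would be a multiple of `(x, y)`. -/
theorem nonempty_equiv_of_highestWeight {M N : Type*} [AddCommGroup M] [Module ℂ M]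
    [LieRingModule (so m) M] [LieModule ℂ (so m) M] [AddCommGroup N] [Module ℂ N]
    [LieRingModule (so m) N] [LieModule ℂ (so m) N] {μ : Dual ℂ (cartan m)}
    (hM : IsIrrepOfHighestWeight m M μ) (hN : IsIrrepOfHighestWeight m N μ) :
    Nonempty (M ≃ₗ⁅ℂ, so m⁆ N) := by
  obtain ⟨x, hx0, hxH, hxn⟩ := hM.highestWeight
  obtain ⟨y, hy0, hyH, hyn⟩ := hN.highestWeight
  have hH : ∀ H : cartan m, ⁅(H : so m), (x, y)⁆ = μ H • (x, y) := fun H =>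
    Prod.ext (hxH H) (hyH H)
  have hn : ∀ X ∈ nilp m, ⁅X, (x, y)⁆ = 0 := fun X hX => Prod.ext (hxn X hX) (hyn X hX)
  refine nonempty_equiv_of_graph hM.irreducible hN.irreducible hx0 hy0
    (G := LieSubmodule.lieSpan ℂ (so m) {(x, y)})
    (LieSubmodule.subset_lieSpan (Set.mem_singleton _)) (fun h => ?_) (fun h => ?_)
  · have h1 := mem_span_of_mem_lieSpan hH hn h
      (Prod.ext (hxH ⟨_, gradingElt_mem⟩) (by simp [prod_lie]))
    obtain ⟨c, hc⟩ := Submodule.mem_span_singleton.1 h1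
    have hc1 : c • x = x := congrArg Prod.fst hc
    have hc2 : c • y = 0 := congrArg Prod.snd hc
    rcases smul_eq_zero.1 hc2 with h0 | h0
    · rw [h0, zero_smul] at hc1
      exact hx0 hc1.symm
    · exact hy0 h0
  · have h1 := mem_span_of_mem_lieSpan hH hn h
      (Prod.ext (by simp [prod_lie]) (hyH ⟨_, gradingElt_mem⟩))
    obtain ⟨c, hc⟩ := Submodule.mem_span_singleton.1 h1
    have hc1 : c • x = 0 := congrArg Prod.fst hc
    have hc2 : c • y = y := congrArg Prod.snd hc
    rcases smul_eq_zero.1 hc1 with h0 | h0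
    · rw [h0, zero_smul] at hc2
      exact hy0 hc2.symm
    · exact hx0 h0

/-! ### The dual of the Weyl-type forms -/

theorem cartan_lie_bv (H : cartan m) (i j : Fin (2 * m)) :
    ⁅(H : so m), bv m (e i) (e j)⁆ = (eps i H + eps j H) • bv m (e i) (e j) := by
  have hd : ∀ j, (H : so m).1 (e j) = eps j H • e j := by
    intro j
    ext i
    rw [← entry_eq]
    by_cases hij : i = j
    · subst hij; simp [eps]
    · rw [H.2 i j hij]; simp [hij]
  rw [lie_bv, hd, hd, map_smul, map_smul, LinearMap.smul_apply, add_smul]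

theorem nilp_lie_bv (hm : 4 ≤ m) {X : so m} (hX : X ∈ nilp m) :
    ⁅X, bv m (e ⟨0, by omega⟩) (e ⟨1, by omega⟩)⁆ = 0 := by
  have h0 : 0 < 2 * m := by omega
  have h1 : 1 < 2 * m := by omega
  have z0 : X.1 (e ⟨0, h0⟩) = 0 := by
    ext i
    rw [← entry_eq, hX i _ (Fin.mk_le_of_le_val (Nat.zero_le _))]; rfl
  have z1 : X.1 (e ⟨1, h1⟩) = entry X ⟨0, h0⟩ ⟨1, h1⟩ • e ⟨0, h0⟩ := by
    ext i
    rw [← entry_eq]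
    by_cases hi : i = ⟨0, h0⟩
    · subst hi; simp
    · rw [hX i _ (by
        have : i.1 ≠ 0 := fun h => hi (Fin.ext h)
        exact Fin.mk_le_of_le_val (by omega))]
      simp [hi]
  rw [lie_bv, z0, z1, map_zero, LinearMap.zero_apply, map_smul, bv_self, smul_zero, add_zero]

/-- Evaluation of Weyl-type forms at an element of `so_{2m}`. -/
def weylEval (Z : so m) : Dual ℂ (weyl m) where
  toFun q := (q : QuadraticForm ℂ (so m)) Z
  map_add' _ _ := rfl
  map_smul' _ _ := rfl

theorem hasHighestWeightVector_dual {E : Type*} [AddCommGroup E] [Module ℂ E]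
    [LieRingModule (so m) E] [LieModule ℂ (so m) E] {μ : Dual ℂ (cartan m)} {f : Dual ℂ E}
    (hf : ∃ x, f x ≠ 0) (hH : ∀ (H : cartan m) (x : E), f ⁅(H : so m), x⁆ = - (μ H * f x))
    (hn : ∀ X ∈ nilp m, ∀ x : E, f ⁅X, x⁆ = 0) :
    HasHighestWeightVector m (Dual ℂ E) μ := by
  refine ⟨f, fun h => ?_, fun H => LinearMap.ext fun x => ?_, fun X hX => LinearMap.ext fun x => ?_⟩
  · obtain ⟨x, hx⟩ := hf
    exact hx (by rw [h, LinearMap.zero_apply])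
  · rw [Module.Dual.lie_apply, hH, neg_neg, LinearMap.smul_apply, smul_eq_mul]
  · rw [Module.Dual.lie_apply, hn X hX, neg_zero, LinearMap.zero_apply]

theorem quad_lie_of_eigen {X Z : so m} {c : ℂ} (h : ⁅X, Z⁆ = c • Z)
    (q : QuadraticForm ℂ (so m)) : ⁅X, q⁆ Z = - (2 * c * q Z) := by
  rw [lie_quad_eq, h, map_smul, polarBilin_self, smul_eq_mul]
  ring

theorem weylEval_lie (X Z : so m) (q : weyl m) :
    weylEval Z ⁅X, q⁆ = ⁅X, (q : QuadraticForm ℂ (so m))⁆ Z := rfl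

/-- Evaluation at `e₁ ∧ e₂` is the highest weight vector: forms are quadratic, so the weight `ψ` is
doubled, and the sign of the action on forms cancels that of the dual. -/
theorem dual_weyl_isIrrep (hm : 4 ≤ m) :
    IsIrrepOfHighestWeight m (Dual ℂ (weyl m)) ((2 : ℂ) • highestRoot m hm) := by
  have h0 : 0 < 2 * m := by omega
  have h1 : 1 < 2 * m := by omega
  obtain ⟨a, ha⟩ : ∃ a : V m, a = e ⟨0, h0⟩ := ⟨_, rfl⟩
  obtain ⟨b, hb⟩ : ∃ b : V m, b = e ⟨1, h1⟩ := ⟨_, rfl⟩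
  have hH : ∀ H : cartan m, ⁅(H : so m), bv m a b⁆ =
      (eps ⟨0, h0⟩ H + eps ⟨1, h1⟩ H) • bv m a b := by
    intro H
    rw [ha, hb]
    exact cartan_lie_bv H _ _
  have hX : ∀ X ∈ nilp m, ⁅X, bv m a b⁆ = 0 := by
    intro X hX
    rw [ha, hb]
    exact nilp_lie_bv hm hX
  have ha0 : a ≠ 0 := fun h => by simpa [ha] using congrFun h ⟨0, h0⟩
  have hba : b ∉ Submodule.span ℂ {a} := by
    intro h
    obtain ⟨c, hc⟩ := Submodule.mem_span_singleton.1 h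
    simpa [ha, hb] using congrFun hc ⟨1, h1⟩
  have haa : form m a a = 0 := by
    rw [ha, form_e_e, if_neg]
    intro h
    have := congrArg Fin.val h
    rw [Fin.val_rev] at this
    simp only at this
    omega
  have hbb : form m b b = 0 := by
    rw [hb, form_e_e, if_neg]
    intro h
    have := congrArg Fin.val h
    rw [Fin.val_rev] at this
    simp only at this
    omega
  have hab : form m a b = 0 := by
    rw [ha, hb, form_e_e, if_neg]
    intro h
    have := congrArg Fin.val h
    rw [Fin.val_rev] at this
    simp only at this
    omega
  refine ⟨inferInstance, dual_isIrreducible (weyl_isIrreducible hm ha0 hba haa hbb hab), ?_⟩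
  refine hasHighestWeightVector_dual (f := weylEval (bv m a b)) ?_ (fun H q => ?_)
    (fun X hXn q => ?_)
  · obtain ⟨q, hq, hq0⟩ := exists_mem_weyl_ne_zero hm ha0 hba haa hbb hab
    exact ⟨⟨q, hq⟩, hq0⟩
  · rw [weylEval_lie, quad_lie_of_eigen (hH H)]
    rfl
  · rw [weylEval_lie, lie_quad_eq, hX X hXn, map_zero, neg_zero]

/-! ### Assembling the internal direct sum -/

/-- `V_dec` as a subrepresentation. -/
def decLie (m : ℕ) : LieSubmodule ℂ (so m) (QuadraticForm ℂ (so m)) :=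
  { Vdec m with lie_mem := fun {X _} h => Vdec_lie_mem X h }

/-- `V_iso` as a subrepresentation. -/
def isoLie (m : ℕ) : LieSubmodule ℂ (so m) (QuadraticForm ℂ (so m)) :=
  { Viso m with lie_mem := fun {X _} h => Viso_lie_mem X h }

theorem isInternal_of_three {K E : Type*} [Field K] [AddCommGroup E] [Module K E]
    {A B C : Submodule K E} (hex : ∀ x, ∃ a ∈ A, ∃ b ∈ B, ∃ c ∈ C, a + b + c = x)
    (huniq : ∀ a ∈ A, ∀ b ∈ B, ∀ c ∈ C, a + b + c = 0 → a = 0 ∧ b = 0 ∧ c = 0) :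
    DirectSum.IsInternal ![A, B, C] := by
  have hsum : ∀ f : DirectSum (Fin 3) fun i => (![A, B, C] : Fin 3 → Submodule K E) i,
      DirectSum.coeAddMonoidHom ![A, B, C] f = (f 0 : E) + (f 1 : E) + (f 2 : E) := by
    intro f
    induction f using DirectSum.induction_on with
    | zero => simp
    | of i x =>
      rw [DirectSum.coeAddMonoidHom_of]
      obtain rfl | rfl | rfl : i = 0 ∨ i = 1 ∨ i = 2 := by fin_cases i <;> simp
      · rw [DirectSum.of_eq_same, DirectSum.of_eq_of_ne _ _ _ (by decide),
          DirectSum.of_eq_of_ne _ _ _ (by decide)]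
        simp
      · rw [DirectSum.of_eq_same, DirectSum.of_eq_of_ne _ _ _ (by decide),
          DirectSum.of_eq_of_ne _ _ _ (by decide)]
        simp
      · rw [DirectSum.of_eq_same, DirectSum.of_eq_of_ne _ _ _ (by decide),
          DirectSum.of_eq_of_ne _ _ _ (by decide)]
        simp
    | add f g hf hg =>
      rw [map_add, hf, hg]
      simp only [DirectSum.add_apply, Submodule.coe_add]
      abel
  constructor
  · rw [injective_iff_map_eq_zero]
    intro f hf
    rw [hsum] at hf
    obtain ⟨h0, h1, h2⟩ := huniq _ (f 0).2 _ (f 1).2 _ (f 2).2 hf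
    refine DFinsupp.ext fun i => ?_
    fin_cases i
    · exact Subtype.ext h0
    · exact Subtype.ext h1
    · exact Subtype.ext h2
  · intro x
    obtain ⟨a, ha, b, hb, c, hc, rfl⟩ := hex x
    refine ⟨DirectSum.of (fun i => (![A, B, C] : Fin 3 → Submodule K E) i) 0 ⟨a, ha⟩ +
      DirectSum.of (fun i => (![A, B, C] : Fin 3 → Submodule K E) i) 1 ⟨b, hb⟩ +
      DirectSum.of (fun i => (![A, B, C] : Fin 3 → Submodule K E) i) 2 ⟨c, hc⟩, ?_⟩
    rw [map_add, map_add, DirectSum.coeAddMonoidHom_of, DirectSum.coeAddMonoidHom_of,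
      DirectSum.coeAddMonoidHom_of]

end SOQuad

end

theorem mainTheorem8 (m : ℕ) (hm : 4 ≤ m) :
    Function.Injective (SOQuad.Phi m) ∧ Function.Injective (SOQuad.Psi m) ∧
    ∃ C D I : LieSubmodule ℂ (SOQuad.so m) (QuadraticForm ℂ (SOQuad.so m)),
      D.toSubmodule = SOQuad.Vdec m ∧ I.toSubmodule = SOQuad.Viso m ∧
      DirectSum.IsInternal ![C.toSubmodule, D.toSubmodule, I.toSubmodule] ∧
      SOQuad.IsIrrepOfHighestWeight m (Module.Dual ℂ C) ((2 : ℂ) • SOQuad.highestRoot m hm) ∧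
      ∀ (W : Type*) [AddCommGroup W] [Module ℂ W] [LieRingModule (SOQuad.so m) W]
        [LieModule ℂ (SOQuad.so m) W],
        SOQuad.IsIrrepOfHighestWeight m W ((2 : ℂ) • SOQuad.highestRoot m hm) →
          Nonempty (Module.Dual ℂ W ≃ₗ⁅ℂ, SOQuad.so m⁆ C) := by
  refine ⟨SOQuad.Phi_injective, SOQuad.Psi_injective hm, SOQuad.weyl m, SOQuad.decLie m,
    SOQuad.isoLie m, rfl, rfl, ?_, SOQuad.dual_weyl_isIrrep hm, ?_⟩
  · exact SOQuad.isInternal_of_three (SOQuad.exists_decomposition hm)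
      fun a ha b hb c hc h => SOQuad.decomposition_unique hm ha hb hc h
  · intro W _ _ _ _ hW
    -- Transposing `weyl^* ≃ W` gives `W^* ≃ weyl^**`, which is `weyl` by finite dimensionality.
    obtain ⟨f⟩ := SOQuad.nonempty_equiv_of_highestWeight (SOQuad.dual_weyl_isIrrep hm) hW
    exact ⟨(SOQuad.dualLieEquiv f).trans SOQuad.doubleDualLieEquiv.symm⟩
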